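/- **Setting.** Let $N\ge 1$ and $k$ be integers and let $\chi$ be a Dirichlet character modulo $N$. $S_k(\Gamma_0(N),\chi)$ denotes the space of holomorphic cusp forms $f$ on the upper half plane $H$ with $f\left(\frac{az+b}{cz+d}\right)=\chi(d)(cz+d)^kf(z)$ for all $\begin{pmatrix}a&b\\c&d\end{pmatrix}\in\Gamma_0(N)$. The Petersson product of cusp forms $f,g$ for $\Gamma_0(M)$ with the same weight and character is $$\langle f,g\rangle=\frac{1}{(SL_2(\mathbb Z):\Gamma_0(M))}\int_{\mathcal F}f(x+iy)\overline{g(x+iy)}\,y^{k-2}\,dx\,dy,$$ where $\mathcal F$ is a fundamental domain for $\Gamma_0(M)$; it does not depend on the common level $M$ that is chosen. Put $(f|_kV_m)(z)=f(mz)$ for $m\ge1$; this lies in $S_k(\Gamma_0(Nm),\chi)$. For positive integers $\ell\mid m$ let $T(\ell,m)=T_N(\ell,m)$ be the Hecke operator on $S_k(\Gamma_0(N),\chi)$ given by the double coset $\Gamma_0(N)\begin{pmatrix}\ell&0\\0&m\end{pmatrix}\Gamma_0(N)=\bigsqcup_i\Gamma_0(N)\begin{pmatrix}a_i&b_i\\c_i&d_i\end{pmatrix}$,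 that is, $$(f|_kT(\ell,m))(z)=(\ell m)^{k-1}\sum_i\chi(a_i)(c_iz+d_i)^{-k}f\left(\frac{a_iz+b_i}{c_iz+d_i}\right),$$ and let $T(n)=\sum_{\ell m=n,\ \ell\mid m}T(\ell,m)$. A primitive form (normalized newform) $f\in S_k(\Gamma_0(N),\chi)$ is a common eigenfunction of all $T(n)$, $n\ge1$, with first Fourier coefficient $1$, that is orthogonal to all $g|_kV_\ell$ with $g\in S_k(\Gamma_0(M),\psi)$, where $M$ is a proper divisor of $N$, $M\ell\mid N$, and $\psi$ is a character modulo $M$ inducing $\chi$. **Theorem.** Let $f\in S_k(\Gamma_0(N),\chi)$ be a primitive form. Then for every $r\ge1$ the form $f$ is an eigenfunction of $T(1,r)$; let $\lambda(1,r)$ be its eigenvalue. For all positive integers $m,n$ with $\gcd(m,n)=d$, $$\langle f|_kV_m,f|_kV_n\rangle=\frac{\lambda\left(1,\frac nd\right)\overline{\lambda\left(1,\frac md\right)}}{\left(\frac{mn}{d}\right)^k\displaystyle\prod_{p\,\mid\,\frac{mn}{d^2},\ p\,\nmid\,N}\left(1+\frac1p\right)}\,\langle f,f\rangle,$$ where $p$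 runs over primes. -/

import Mathlib

open scoped MatrixGroups ModularForm ComplexConjugate

noncomputable section

namespace GramMatrix

/-- The space `S_k(Γ₀(N), χ)` of cusp forms of weight `k` and character `χ`, as a subspace of the
cusp forms for `Γ₁(N)`: those `f` with `f |_k γ = χ(d) f` for all `γ = (a b; c d) ∈ Γ₀(N)`. -/
def cuspForms (N : ℕ) (k : ℤ) (χ : DirichletCharacter ℂ N) :
    Submodule ℂ
      (CuspForm ((CongruenceSubgroup.Gamma1 N : Subgroup SL(2, ℤ)) : Subgroup (GL (Fin 2) ℝ)) k) where
  carrier := {f | ∀ γ : SL(2, ℤ), γ ∈ CongruenceSubgroup.Gamma0 N →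
    (f : UpperHalfPlane → ℂ) ∣[k] γ = χ ((γ 1 1 : ℤ) : ZMod N) • (f : UpperHalfPlane → ℂ)}
  add_mem' {f g} hf hg γ hγ := by
    rw [FunLike.coe_add, SlashAction.add_slash, hf γ hγ, hg γ hγ, smul_add]
  zero_mem' γ hγ := by
    rw [FunLike.coe_zero, SlashAction.zero_slash, smul_zero]
  smul_mem' c f hf γ hγ := by
    rw [FunLike.coe_smul, ModularForm.SL_smul_slash, hf γ hγ, smul_comm]

/-- The operator `V_m`: `(f | V_m)(z) = f(m z)` (for `m ≥ 1`). -/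
def V (m : ℕ) (f : UpperHalfPlane → ℂ) : UpperHalfPlane → ℂ :=
  fun z ↦ f (UpperHalfPlane.ofComplex ((m : ℂ) * (z : ℂ)))

/-- A fundamental domain for `Γ₀(N)`: the union of the translates `g⁻¹ 𝒟`, where `𝒟` is the
standard fundamental domain of `SL(2, ℤ)` and `g` runs through representatives of
`SL(2, ℤ) / Γ₀(N)`, so that `SL(2, ℤ)` is the disjoint union of the `Γ₀(N) g⁻¹`. -/
def fundamentalDomain (N : ℕ) : Set UpperHalfPlane :=
  {z | ∃ q : SL(2, ℤ) ⧸ CongruenceSubgroup.Gamma0 N, q.out • z ∈ ModularGroup.fd}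

/-- The normalized Petersson product
`⟨f, g⟩ = (SL₂(ℤ) : Γ₀(N))⁻¹ ∫_F f(z) conj(g(z)) y^(k-2) dx dy` over a fundamental domain `F` of
`Γ₀(N)`. The measure on the upper half plane is `dx dy / y²`, and `UpperHalfPlane.petersson k g f`
is the function `conj(g(z)) f(z) y^k`. -/
def petersson (N : ℕ) (k : ℤ) (f g : UpperHalfPlane → ℂ) : ℂ :=
  ((CongruenceSubgroup.Gamma0 N).index : ℂ)⁻¹ *
    ∫ z in fundamentalDomain N, UpperHalfPlane.petersson k g f z

/-- The double coset `Γ₀(N) diag(l, m) Γ₀(N)` inside `GL(2, ℝ)` (for `l, m ≥ 1`). -/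
def doubleCoset (N l m : ℕ) : Set (GL (Fin 2) ℝ) :=
  {β | ∃ γ₁ ∈ CongruenceSubgroup.Gamma0 N, ∃ γ₂ ∈ CongruenceSubgroup.Gamma0 N,
    (β : Matrix (Fin 2) (Fin 2) ℝ) =
      ((γ₁ : Matrix (Fin 2) (Fin 2) ℤ) * !![(l : ℤ), 0; 0, (m : ℤ)] *
        (γ₂ : Matrix (Fin 2) (Fin 2) ℤ)).map (Int.cast : ℤ → ℝ)}

/-- The Hecke operator `T_N(l, m)` (for `l ∣ m`) on forms of weight `k` and character `χ` for
`Γ₀(N)`: if `Γ₀(N) diag(l, m) Γ₀(N)` is the disjoint union of the cosets `Γ₀(N) β_i`, where `β_i`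
is an integral matrix with upper left entry `a_i`, then
`(f | T_N(l, m))(z) = (lm)^(k-1) ∑_i χ(a_i) (c_i z + d_i)^(-k) f(β_i z)`.
The slash operator used here carries the factor `det^(k-1)`, and the summands do not depend on the
choice of the `β_i` if `f` has weight `k` and character `χ`. If `l` is not prime to `N` then
all `χ(a_i)` vanish and the operator is zero. -/
def heckeT (N : ℕ) (k : ℤ) (χ : DirichletCharacter ℂ N) (l m : ℕ) (f : UpperHalfPlane → ℂ) :
    UpperHalfPlane → ℂ :=
  ∑ᶠ q ∈ (Quotient.mk (QuotientGroup.rightRel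
      ((CongruenceSubgroup.Gamma0 N : Subgroup SL(2, ℤ)) : Subgroup (GL (Fin 2) ℝ)))) ''
        doubleCoset N l m,
    χ ((⌊(q.out : GL (Fin 2) ℝ) 0 0⌋ : ℤ) : ZMod N) • (f ∣[k] (q.out : GL (Fin 2) ℝ))

/-- The Hecke operator `T_N(n) = ∑ T_N(l, m)`, the sum over all `l, m` with `l m = n`, `l ∣ m`. -/
def heckeTn (N : ℕ) (k : ℤ) (χ : DirichletCharacter ℂ N) (n : ℕ) (f : UpperHalfPlane → ℂ) :
    UpperHalfPlane → ℂ :=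
  ∑ x ∈ n.divisorsAntidiagonal with x.1 ∣ x.2, heckeT N k χ x.1 x.2 f

/-- A primitive form (normalized newform) in `S_k(Γ₀(N), χ)`: a cusp form with first Fourier
coefficient `1` that is an eigenfunction of all Hecke operators `T_N(n)` and orthogonal to all
oldforms `g | V_l`, where `g ∈ S_k(Γ₀(M), ψ)` for a proper divisor `M` of `N` with `M l ∣ N` and a
character `ψ` mod `M` which induces `χ`. -/
structure IsPrimitiveForm (N : ℕ) (k : ℤ) (χ : DirichletCharacter ℂ N)
    (f : CuspForm ((CongruenceSubgroup.Gamma1 N : Subgroup SL(2, ℤ)) : Subgroup (GL (Fin 2) ℝ)) k) :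
    Prop where
  mem : f ∈ cuspForms N k χ
  new : ∀ (M l : ℕ) (hM : M ∣ N), M ≠ N → M * l ∣ N →
    ∀ ψ : DirichletCharacter ℂ M, DirichletCharacter.changeLevel hM ψ = χ →
      ∀ g ∈ cuspForms M k ψ, petersson N k f (V l g) = 0
  normalized : (UpperHalfPlane.qExpansion 1 f).coeff 1 = 1
  eigen : ∀ n : ℕ, 0 < n → ∃ c : ℂ, heckeTn N k χ n f = c • (f : UpperHalfPlane → ℂ)

end GramMatrix

end

/-! Put m' = m/d, n' = n/d, D = lcm(m, n) = m n' = n m', and write F_r for f slashed by diag(1, r),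
a multiple of f(z/r). Since f(mz) = f(Dz/n') and f(nz) = f(Dz/m'), the substitution z ↦ Dz turns
⟨f|V_m, f|V_n⟩ into n'm' D^(-k) times the pairing of F_{n'} and F_{m'} (`petersson_V_eq_pairing`),
where n' and m' are coprime.

The operator T(1, n') sums χ(a) F_{n'}|γ over the cosets Γ₀(N) diag(1, n') γ. By coprimality every γ
can be taken in Γ₀(N) ∩ Γ⁰(m') (`rightCoset_image_doubleCoset_of_coprime`). Such γ multiply F_{m'}
by χ(d), with χ(a)χ(d) = 1, so all cosets contribute equally to the pairing with F_{m'}: λ(1, n')⟨f,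
F_{m'}⟩ is the number of cosets times ⟨F_{n'}, F_{m'}⟩ (`pairing_heckeT`). The same with (m', 1) in
place of (n', m') reduces ⟨f, F_{m'}⟩ to ⟨f, f⟩ (`pairing_diagGL`). The coset numbers multiply to
the index of Γ₀(N) ∩ Γ⁰(n'm') in Γ₀(N), which is n'm' ∏ (1 + 1/p) (`relIndex_Gamma00`).

That f is an eigenfunction of every T(1, r) follows by induction from T(l, lr) = χ(l) l^(k-2) T(1,
r).

The changes of group and variable rest on one principle: an invariant function has the same average
for every weight whose orbit sums are constant (`IsWeight.average_eq`). Normalized Petersson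
products are such averages, up to the volume of the standard fundamental domain. -/

open MeasureTheory
open scoped ENNReal

namespace GramMatrix

/-! ### Averages of invariant functions by unfolding -/

section Weights

/-- A weight of total mass `c` for the action of `G` on `X`: a measurable function whose sum over
almost every orbit is `c`. The indicator function of a fundamental domain is an example. -/
structure IsWeight (G : Type*) {X : Type*} [Group G] [MulAction G X] [MeasurableSpace X]
    (μ : Measure X) (c : ℝ≥0∞) (u : X → ℝ≥0∞) : Prop where
  measurable : Measurable u
  tsum_smul : ∀ᵐ x ∂μ, ∑' g : G, u (g • x) = c

variable {G X : Type*} [Group G] [MulAction G X] [MeasurableSpace X] {μ : Measure X} {c : ℝ≥0∞}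
  {u v : X → ℝ≥0∞}

theorem setLIntegral_mul_smul [MeasurableConstSMul G X] [SMulInvariantMeasure G X μ]
    (hu : Measurable u) (hv : Measurable v) {A : Set X}
    (hA : MeasurableSet A) (g : G) (hgA : (g • ·) ⁻¹' A = A) :
    ∫⁻ x in A, u x * v (g • x) ∂μ = ∫⁻ x in A, v x * u (g⁻¹ • x) ∂μ := by
  have h := (measurePreserving_smul g μ).setLIntegral_comp_preimage (s := A)
    (f := fun x ↦ v x * u (g⁻¹ • x)) hA (by fun_prop)
  rw [hgA] at h
  rw [← h]
  simp [mul_comm]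

/-- Unfolding: c is replaced under the integral by the orbit sum of `v`. -/
theorem IsWeight.mul_withDensity_apply [Countable G] [MeasurableConstSMul G X]
    (hu : Measurable u) (hv : IsWeight G μ c v)
    {A : Set X} (hA : MeasurableSet A) :
    c * μ.withDensity u A = ∑' g : G, ∫⁻ x in A, u x * v (g • x) ∂μ := by
  have hvm := hv.measurable
  rw [withDensity_apply _ hA, ← lintegral_const_mul _ hu,
    ← lintegral_tsum (fun g ↦ by fun_prop)]
  refine setLIntegral_congr_fun_ae hA ?_
  filter_upwards [hv.tsum_smul] with x hx _
  rw [ENNReal.tsum_mul_left, hx, mul_comm]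

/-- Two weights for the same group give the same mass to invariant sets. -/
theorem IsWeight.withDensity_apply_eq [Countable G] [MeasurableConstSMul G X]
    [SMulInvariantMeasure G X μ] (hu : IsWeight G μ c u)
    (hv : IsWeight G μ c v) (hc : c ≠ 0) (hc' : c ≠ ∞) {A : Set X} (hA : MeasurableSet A)
    (hgA : ∀ g : G, (g • ·) ⁻¹' A = A) :
    μ.withDensity u A = μ.withDensity v A := by
  -- Each side times c is unfolded with the other weight; the substitution x ↦ g⁻¹x followed by g ↦
  -- g⁻¹ exchanges the two sums.
  rw [← ENNReal.mul_right_inj hc hc', hv.mul_withDensity_apply hu.measurable hA,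
    hu.mul_withDensity_apply hv.measurable hA]
  simp_rw [setLIntegral_mul_smul hu.measurable hv.measurable hA _ (hgA _)]
  exact (Equiv.inv G).tsum_eq (fun g ↦ ∫⁻ x in A, v x * u (g • x) ∂μ)

/-- The average of an invariant function depends only on the masses of the invariant sets. -/
theorem average_eq_of_invariant {ν₁ ν₂ : Measure X} {a : ℝ≥0∞} (ha : a ≠ 0) (ha' : a ≠ ∞)
    (h : ∀ A : Set X, MeasurableSet A → (∀ g : G, (g • ·) ⁻¹' A = A) → ν₁ A = a * ν₂ A)
    {φ : X → ℂ} (hφ : Measurable φ) (hinv : ∀ (g : G) x, φ (g • x) = φ x) :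
    ⨍ x, φ x ∂ν₁ = ⨍ x, φ x ∂ν₂ := by
  -- Preimages under `φ` are invariant sets, so the two image measures on ℂ are proportional; the
  -- factor `a` cancels in the average.
  have hmap : ν₁.map φ = a • ν₂.map φ := by
    ext B hB
    rw [Measure.map_apply hφ hB, Measure.smul_apply, Measure.map_apply hφ hB, smul_eq_mul,
      h _ (hφ hB) fun g ↦ by ext x; simp [hinv]]
  have hint : ∫ x, φ x ∂ν₁ = a.toReal • ∫ x, φ x ∂ν₂ := by
    have hid : AEStronglyMeasurable (id : ℂ → ℂ) (ν₂.map φ) := by fun_prop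
    have h₁ := integral_map (μ := ν₁) (f := (id : ℂ → ℂ)) hφ.aemeasurable (by fun_prop)
    rw [hmap, integral_smul_measure, integral_map hφ.aemeasurable hid] at h₁
    exact h₁.symm
  have hreal : ν₁.real Set.univ = a.toReal * ν₂.real Set.univ := by
    simp [Measure.real, h Set.univ MeasurableSet.univ fun g ↦ Set.preimage_univ]
  have : a.toReal ≠ 0 := by simp [ENNReal.toReal_eq_zero_iff, ha, ha']
  rw [average_eq, average_eq, hint, hreal, mul_inv, smul_smul, mul_right_comm,
    inv_mul_cancel₀ this, one_mul]

/-- Averages of invariant functions do not depend on the weight. -/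
theorem IsWeight.average_eq [Countable G] [MeasurableConstSMul G X] [SMulInvariantMeasure G X μ]
    (hu : IsWeight G μ c u) (hv : IsWeight G μ c v)
    (hc : c ≠ 0) (hc' : c ≠ ∞) {φ : X → ℂ} (hφ : Measurable φ)
    (hinv : ∀ (g : G) x, φ (g • x) = φ x) :
    ⨍ x, φ x ∂μ.withDensity u = ⨍ x, φ x ∂μ.withDensity v :=
  average_eq_of_invariant (G := G) one_ne_zero ENNReal.one_ne_top
    (fun A hA hgA ↦ by rw [one_mul, hu.withDensity_apply_eq hv hc hc' hA hgA]) hφ hinv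

theorem bijective_out_mul (K : Subgroup G) :
    Function.Bijective fun p : (G ⧸ K) × K ↦ p.1.out * (p.2 : G) := by
  constructor
  · rintro ⟨q, k⟩ ⟨q', k'⟩ h
    have hq : q = q' := by
      have := congrArg (QuotientGroup.mk (s := K)) h
      simpa [QuotientGroup.mk_mul_of_mem] using this
    subst hq
    simpa using h
  · intro g
    obtain ⟨k, hk⟩ := QuotientGroup.mk_out_eq_mul K g
    exact ⟨(g, k⁻¹), by simp [hk]⟩

/-- A weight for `G`, summed over the translates by `G ⧸ K`, is a weight for `K`. -/
theorem IsWeight.sum_out_smul [Countable G] [MeasurableConstSMul G X]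
    (hu : IsWeight G μ c u) (K : Subgroup G)
    [Fintype (G ⧸ K)] :
    IsWeight K μ c (fun x ↦ ∑ q : G ⧸ K, u (q.out • x)) := by
  have hum := hu.measurable
  refine ⟨by fun_prop, ?_⟩
  filter_upwards [hu.tsum_smul] with x hx
  rw [← hx, ← (Equiv.ofBijective _ (bijective_out_mul K)).tsum_eq,
    ENNReal.tsum_prod', ENNReal.tsum_comm]
  refine tsum_congr fun k ↦ ?_
  rw [tsum_fintype]
  refine Finset.sum_congr rfl fun q _ ↦ ?_
  congr 1
  rw [Subgroup.smul_def, smul_smul]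
  rfl

theorem withDensity_sum_smul_apply [MeasurableConstSMul G X] [SMulInvariantMeasure G X μ]
    {ι : Type*} (s : Finset ι) (t : ι → G) (hu : Measurable u)
    {A : Set X} (hA : MeasurableSet A) (hgA : ∀ g : G, (g • ·) ⁻¹' A = A) :
    μ.withDensity (fun x ↦ ∑ i ∈ s, u (t i • x)) A = s.card * μ.withDensity u A := by
  rw [withDensity_apply _ hA, lintegral_finsetSum _ (fun i _ ↦ by fun_prop),
    withDensity_apply _ hA, ← nsmul_eq_mul]
  refine Finset.sum_eq_card_nsmul fun i _ ↦ ?_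
  have h := (measurePreserving_smul (t i) μ).setLIntegral_comp_preimage (s := A) (f := u) hA hu
  rwa [hgA] at h

/-- Averages of `G`-invariant functions over `G` and over a subgroup of finite index agree. -/
theorem average_sum_out_smul [MeasurableConstSMul G X] [SMulInvariantMeasure G X μ]
    (hu : Measurable u) (K : Subgroup G) [Fintype (G ⧸ K)]
    {φ : X → ℂ} (hφ : Measurable φ) (hinv : ∀ (g : G) x, φ (g • x) = φ x) :
    ⨍ x, φ x ∂μ.withDensity (fun x ↦ ∑ q : G ⧸ K, u (q.out • x)) =
      ⨍ x, φ x ∂μ.withDensity u := by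
  refine average_eq_of_invariant (G := G) (a := (Finset.univ : Finset (G ⧸ K)).card) ?_ ?_
    (fun A hA hgA ↦ withDensity_sum_smul_apply _ _ hu hA hgA) hφ hinv
  · simp
  · simp

/-- Transport of weights along an equivariant measure-preserving map. -/
theorem IsWeight.comp {G' X' : Type*} [Group G'] [MeasurableSpace X'] [MulAction G' X']
    {μ' : Measure X'} {f : X' → X} (hu : IsWeight G μ c u) (hf : MeasurePreserving f μ' μ)
    (e : G' ≃ G) (he : ∀ g x, f (g • x) = e g • f x) : IsWeight G' μ' c (u ∘ f) := by
  refine ⟨hu.measurable.comp hf.measurable, ?_⟩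
  filter_upwards [hf.quasiMeasurePreserving.ae hu.tsum_smul] with x hx
  rw [← hx, ← e.tsum_eq]
  simp [he]

theorem average_comp_withDensity_comp {X' : Type*} [MeasurableSpace X'] {μ' : Measure X'}
    {f : X' → X} (hf : MeasurePreserving f μ' μ) (hu : Measurable u) {φ : X → ℂ}
    (hφ : Measurable φ) :
    ⨍ x, φ (f x) ∂μ'.withDensity (u ∘ f) = ⨍ x, φ x ∂μ.withDensity u := by
  have hmp : MeasurePreserving f (μ'.withDensity (u ∘ f)) (μ.withDensity u) := by
    refine ⟨hf.measurable, ?_⟩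
    ext A hA
    rw [Measure.map_apply hf.measurable hA, withDensity_apply _ hA,
      withDensity_apply _ (hf.measurable hA), ← hf.setLIntegral_comp_preimage hA hu]
    rfl
  rw [average_eq, average_eq, ← hmp.map_eq, integral_map hf.measurable.aemeasurable (by fun_prop),
    hmp.map_eq,
    measureReal_def, measureReal_def, ← hmp.measure_preimage MeasurableSet.univ.nullMeasurableSet,
    Set.preimage_univ]

end Weights

/-! ### The standard fundamental domain of SL(2, ℤ) -/

section FundamentalDomain

open UpperHalfPlane ModularGroup

instance : SMulInvariantMeasure SL(2, ℤ) ℍ volume where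
  measure_preimage_smul g _ hs :=
    measure_preimage_smul_of_nullMeasurableSet (μ := (volume : Measure ℍ))
      hs.nullMeasurableSet (Matrix.SpecialLinearGroup.mapGL ℝ g)

instance : MeasurableConstSMul SL(2, ℤ) ℍ where
  measurable_const_smul g := measurable_const_smul (Matrix.SpecialLinearGroup.mapGL ℝ g)

instance : Countable SL(2, ℤ) :=
  Function.Injective.countable (f := fun (g : SL(2, ℤ)) (i j : Fin 2) ↦ g i j)
    fun _ _ h ↦ Subtype.ext h

instance (K : Subgroup SL(2, ℤ)) : MeasurableConstSMul K ℍ where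
  measurable_const_smul g := measurable_const_smul (g : SL(2, ℤ))

instance (K : Subgroup SL(2, ℤ)) : SMulInvariantMeasure K ℍ volume where
  measure_preimage_smul g _ hs :=
    measure_preimage_smul_of_nullMeasurableSet (μ := (volume : Measure ℍ))
      hs.nullMeasurableSet (g : SL(2, ℤ))

theorem volume_eq_zero_of_image_coe {s : Set ℍ} (hs : volume (UpperHalfPlane.coe '' s) = 0) :
    volume s = 0 := by
  rw [volume_eq_lintegral, setLIntegral_measure_zero _ _ hs]

theorem volume_re_eq (c : ℝ) : volume {z : ℍ | z.re = c} = 0 := by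
  apply volume_eq_zero_of_image_coe
  refine measure_mono_null (t := Complex.measurableEquivRealProd ⁻¹' ({c} ×ˢ Set.univ)) ?_ ?_
  · rintro _ ⟨z, hz, rfl⟩
    simpa [Complex.measurableEquivRealProd] using hz
  · rw [Complex.volume_preserving_equiv_real_prod.measure_preimage (by measurability),
      Measure.volume_eq_prod, Measure.prod_prod]
    simp

theorem volume_norm_eq (r : ℝ) : volume {z : ℍ | ‖(z : ℂ)‖ = r} = 0 := by
  apply volume_eq_zero_of_image_coe
  refine measure_mono_null (t := Metric.sphere (0 : ℂ) r) ?_ (Measure.addHaar_sphere _ _ _)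
  rintro _ ⟨z, hz, rfl⟩
  simpa using hz

/-- The ball of radius 1/4 about 2i lies in `fd`, and the density y⁻² has no zero on it. -/
theorem volume_fd_ne_zero : volume fd ≠ 0 := by
  intro h
  have hopen : IsOpen (UpperHalfPlane.coe ⁻¹' Metric.ball (2 * Complex.I) (1 / 4)) :=
    Metric.isOpen_ball.preimage continuous_coe
  have hsub : Metric.ball (2 * Complex.I) (1 / 4) ⊆ UpperHalfPlane.coe '' fd := by
    intro z hz
    have h1 := (Complex.abs_re_le_norm _).trans_lt (mem_ball_iff_norm.mp hz)
    have h2 := (Complex.abs_im_le_norm _).trans_lt (mem_ball_iff_norm.mp hz)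
    simp only [Complex.sub_re, Complex.mul_re, Complex.re_ofNat, Complex.I_re, mul_zero,
      Complex.im_ofNat, Complex.I_im, mul_one, sub_self, sub_zero, Complex.sub_im, Complex.mul_im,
      add_zero] at h1 h2
    rw [abs_lt] at h1 h2
    have him : 0 < z.im := by linarith
    refine ⟨⟨z, him⟩, ⟨?_, ?_⟩, rfl⟩
    · simp only [Complex.normSq_apply]
      nlinarith [mul_self_nonneg z.re]
    · change |z.re| ≤ 1 / 2
      rw [abs_le]
      constructor <;> linarith
  rw [volume_eq_lintegral] at h
  have h0 := lintegral_mono_set (μ := volume)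
    (f := fun z : ℂ ↦ (((1 / ‖z.im‖₊) ^ 2 : NNReal) : ℝ≥0∞)) hsub
  rw [h, nonpos_iff_eq_zero, lintegral_eq_zero_iff (by fun_prop), Filter.EventuallyEq,
    ae_restrict_iff' Metric.isOpen_ball.measurableSet] at h0
  have hnull : volume (Metric.ball (2 * Complex.I) (1 / 4)) = 0 := by
    refine measure_mono_null ?_ h0
    intro z hz
    have h2 := (Complex.abs_im_le_norm _).trans_lt (mem_ball_iff_norm.mp hz)
    simp only [Complex.sub_im, Complex.mul_im, Complex.re_ofNat, Complex.I_im, mul_one,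
      Complex.im_ofNat, Complex.I_re, mul_zero, add_zero] at h2
    rw [abs_lt] at h2
    have him : z.im ≠ 0 := by intro h; rw [h] at h2; linarith
    simpa [him] using hz
  exact (Metric.measure_ball_pos volume _ (by norm_num)).ne' hnull

/-- `fd` lies in the half-strip |x| ≤ 1/2, y > 1/2, where y⁻² is integrable. -/
theorem volume_fd_ne_top : volume fd ≠ ∞ := by
  have hsub : UpperHalfPlane.coe '' fd ⊆
      Complex.measurableEquivRealProd ⁻¹' (Set.Icc (-(1 / 2)) (1 / 2) ×ˢ Set.Ioi (1 / 2)) := by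
    rintro _ ⟨z, hz, rfl⟩
    have h1 := abs_le.mp hz.2
    have h2 := three_le_four_mul_im_sq_of_mem_fd hz
    have h3 : 1 / 2 < z.im := by nlinarith [z.im_pos]
    exact ⟨h1, h3⟩
  rw [volume_eq_lintegral]
  refine ne_top_of_le_ne_top ?_ (lintegral_mono_set hsub)
  have hm : Measurable fun p : ℝ × ℝ ↦ (((1 / ‖p.2‖₊) ^ 2 : NNReal) : ℝ≥0∞) := by fun_prop
  have key := Complex.volume_preserving_equiv_real_prod.setLIntegral_comp_preimage
    (s := Set.Icc (-(1 / 2 : ℝ)) (1 / 2) ×ˢ Set.Ioi (1 / 2 : ℝ)) (by measurability) hm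
  refine ne_of_eq_of_ne key ?_
  rw [Measure.volume_eq_prod, setLIntegral_prod _ hm.aemeasurable]
  simp only [lintegral_const, Measure.restrict_apply MeasurableSet.univ, Set.univ_inter,
    Real.volume_Icc]
  refine ENNReal.mul_ne_top (ne_of_lt ?_) (by simp)
  have hint := integrableOn_Ioi_rpow_of_lt (a := -2) (c := 1 / 2) (by norm_num) (by norm_num)
  refine lt_of_le_of_lt (setLIntegral_mono' measurableSet_Ioi fun y hy ↦ le_of_eq ?_)
    hint.hasFiniteIntegral
  have hy : (0 : ℝ) < y := lt_trans (by norm_num) hy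
  rw [enorm_eq_nnnorm, ENNReal.coe_inj]
  ext
  simp [Real.rpow_neg hy.le, abs_of_pos hy]

/-- The points on the boundary lines of the standard fundamental domain. -/
def boundaryLines : Set ℍ := {z | z.re = -1 / 2 ∨ z.re = 1 / 2 ∨ ‖(z : ℂ)‖ = 1}

theorem volume_boundaryLines : volume boundaryLines = 0 :=
  measure_union_null (volume_re_eq _) (measure_union_null (volume_re_eq _) (volume_norm_eq 1))

theorem eq_one_or_neg_one_of_mem_fd {z : ℍ} {g : SL(2, ℤ)} (hb : z ∉ boundaryLines)
    (hz : z ∈ fd) (hg : g • z ∈ fd) : g = 1 ∨ g = -1 := by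
  simp only [boundaryLines, Set.mem_ofPred_eq, not_or] at hb
  -- The corners ρ and ρ + 1, which have extra stabilizers, lie on the boundary lines too.
  have h1 : z ≠ (1 : ℝ) +ᵥ ρ := by
    rintro rfl
    exact hb.2.1 (by norm_num [ρ])
  have h2 : z ≠ ρ := by
    rintro rfl
    exact hb.1 (by simp [ρ])
  have := cases_of_mem_fd_smul_mem_fd hz hg
  tauto

theorem ae_smul_notMem_boundaryLines :
    ∀ᵐ z : ℍ, ∀ g : SL(2, ℤ), g • z ∉ boundaryLines := by
  rw [ae_all_iff]
  intro g
  have : volume ((g • ·) ⁻¹' boundaryLines) = 0 := by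
    rw [measure_preimage_smul, volume_boundaryLines]
  filter_upwards [measure_eq_zero_iff_ae_notMem.mp this] with z hz using hz

/-- The mass is 2 because -1 acts trivially: for generic z exactly two elements, g and -g, move z
into `fd`. -/
theorem isWeight_indicator_fd : IsWeight SL(2, ℤ) volume 2 (fd.indicator (1 : ℍ → ℝ≥0∞)) := by
  refine ⟨measurable_one.indicator isClosed_fd.measurableSet, ?_⟩
  filter_upwards [ae_smul_notMem_boundaryLines] with z hz
  obtain ⟨g, hg⟩ := exists_smul_mem_fd z
  have hne : g ≠ -g := by
    intro h
    have h0 : ∀ i j, g i j = 0 := fun i j ↦ by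
      have := congrArg (fun m : SL(2, ℤ) ↦ m i j) h
      simp only [Matrix.SpecialLinearGroup.coe_neg, Matrix.neg_apply] at this
      omega
    have := g.det_coe
    rw [Matrix.det_fin_two, h0 0 0, h0 0 1] at this
    simp at this
  have hmem : ∀ γ : SL(2, ℤ), γ • z ∈ fd ↔ γ = g ∨ γ = -g := by
    intro γ
    constructor
    · intro hγ
      have := eq_one_or_neg_one_of_mem_fd (g := γ * g⁻¹) (hz g) hg
        (by rwa [smul_smul, inv_mul_cancel_right])
      simpa [mul_inv_eq_iff_eq_mul] using this
    · rintro (rfl | rfl)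
      · exact hg
      · rwa [SL_neg_smul]
  rw [tsum_eq_sum (s := {g, -g})]
  · rw [Finset.sum_pair hne, Set.indicator_of_mem hg,
      Set.indicator_of_mem ((hmem _).mpr (.inr rfl))]
    exact one_add_one_eq_two
  · intro γ hγ
    refine Set.indicator_of_notMem (fun h ↦ hγ ?_) _
    simpa using (hmem γ).mp h

end FundamentalDomain

/-! ### Mean values over Γ \ ℍ -/

section Mean

open UpperHalfPlane ModularGroup

noncomputable instance (Γ : Subgroup SL(2, ℤ)) [Γ.FiniteIndex] : Fintype (SL(2, ℤ) ⧸ Γ) :=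
  Subgroup.fintypeQuotientOfFiniteIndex

/-- The weight for `Γ` that counts translates of the standard fundamental domain. -/
noncomputable def levelWeight (Γ : Subgroup SL(2, ℤ)) [Γ.FiniteIndex] (z : ℍ) : ℝ≥0∞ :=
  ∑ q : SL(2, ℤ) ⧸ Γ, fd.indicator 1 (q.out • z)

theorem isWeight_levelWeight (Γ : Subgroup SL(2, ℤ)) [Γ.FiniteIndex] :
    IsWeight Γ volume 2 (levelWeight Γ) :=
  isWeight_indicator_fd.sum_out_smul Γ

/-- The mean value over `Γ \ ℍ` of a `Γ`-invariant function. -/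
noncomputable def mean (Γ : Subgroup SL(2, ℤ)) [Γ.FiniteIndex] (φ : ℍ → ℂ) : ℂ :=
  ⨍ z, φ z ∂(volume : Measure ℍ).withDensity (levelWeight Γ)

theorem levelMeasure_univ (Γ : Subgroup SL(2, ℤ)) [Γ.FiniteIndex] :
    (volume : Measure ℍ).withDensity (levelWeight Γ) Set.univ = Γ.index * volume fd := by
  have h := withDensity_sum_smul_apply (G := SL(2, ℤ)) (μ := (volume : Measure ℍ)) Finset.univ
    (fun q : SL(2, ℤ) ⧸ Γ ↦ q.out) isWeight_indicator_fd.measurable MeasurableSet.univ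
    (fun _ ↦ Set.preimage_univ)
  rw [withDensity_indicator isClosed_fd.measurableSet, withDensity_one,
    Measure.restrict_apply MeasurableSet.univ, Set.univ_inter, Finset.card_univ,
    ← Nat.card_eq_fintype_card] at h
  exact h

instance (Γ : Subgroup SL(2, ℤ)) [Γ.FiniteIndex] :
    IsFiniteMeasure ((volume : Measure ℍ).withDensity (levelWeight Γ)) := by
  refine ⟨?_⟩
  rw [levelMeasure_univ]
  exact ENNReal.mul_lt_top (ENNReal.natCast_lt_top _) volume_fd_ne_top.lt_top

variable {Γ : Subgroup SL(2, ℤ)} [Γ.FiniteIndex] {φ : ℍ → ℂ}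

theorem mean_eq_of_isWeight {u : ℍ → ℝ≥0∞} (hu : IsWeight Γ volume 2 u) (hφ : Measurable φ)
    (hinv : ∀ g ∈ Γ, ∀ z, φ (g • z) = φ z) :
    ⨍ z, φ z ∂(volume : Measure ℍ).withDensity u = mean Γ φ :=
  hu.average_eq (isWeight_levelWeight Γ) two_ne_zero ENNReal.ofNat_ne_top hφ
    fun g z ↦ hinv g g.2 z

/-- This is the independence of the Petersson product from the level: summing the weight of `Γ` over
`Γ ⧸ K` gives a weight for `K`, and this multiplies the mass of each `Γ`-invariant set by the index.
-/
theorem mean_eq_of_le {K : Subgroup SL(2, ℤ)} [K.FiniteIndex] (hK : K ≤ Γ) (hφ : Measurable φ)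
    (hinv : ∀ g ∈ Γ, ∀ z, φ (g • z) = φ z) : mean K φ = mean Γ φ := by
  have : Fintype (Γ ⧸ K.subgroupOf Γ) := Subgroup.fintypeQuotientOfFiniteIndex
  have hw := (isWeight_levelWeight Γ).sum_out_smul (K.subgroupOf Γ)
  have hw' := hw.comp (MeasurePreserving.id volume) (Subgroup.subgroupOfEquivOfLe hK).symm.toEquiv
    (fun _ _ ↦ rfl)
  rw [← mean_eq_of_isWeight hw' hφ fun g hg ↦ hinv g (hK hg)]
  exact average_sum_out_smul (isWeight_levelWeight Γ).measurable _ hφ fun g z ↦ hinv g g.2 z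

/-- Transport of mean values along a measure-preserving map that normalizes the groups. -/
theorem mean_comp {Γ' : Subgroup SL(2, ℤ)} [Γ'.FiniteIndex] (α : GL (Fin 2) ℝ) (e : Γ' ≃ Γ)
    (he : ∀ (g : Γ') (z : ℍ), α • (g : SL(2, ℤ)) • z = (e g : SL(2, ℤ)) • α • z)
    (hφ : Measurable φ) (hinv : ∀ g ∈ Γ, ∀ z, φ (g • z) = φ z) :
    mean Γ' (fun z ↦ φ (α • z)) = mean Γ φ := by
  have hα := measurePreserving_smul α (volume : Measure ℍ)
  have hw := (isWeight_levelWeight Γ).comp hα e he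
  have hinv' : ∀ g ∈ Γ', ∀ z : ℍ, φ (α • g • z) = φ (α • z) := fun g hg z ↦ by
    rw [he ⟨g, hg⟩, hinv _ (e ⟨g, hg⟩).2]
  rw [← mean_eq_of_isWeight hw (φ := fun z ↦ φ (α • z)) (hφ.comp hα.measurable) hinv',
    average_comp_withDensity_comp hα (isWeight_levelWeight Γ).measurable hφ, mean]

theorem mean_comp_smul [Γ.Normal] (γ : SL(2, ℤ)) (hφ : Measurable φ)
    (hinv : ∀ g ∈ Γ, ∀ z, φ (g • z) = φ z) :
    mean Γ (fun z ↦ φ (γ • z)) = mean Γ φ := by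
  refine mean_comp (Matrix.SpecialLinearGroup.mapGL ℝ γ) (MulAut.conjNormal γ).toEquiv ?_ hφ hinv
  intro g z
  change γ • (g : SL(2, ℤ)) • z = (γ * g * γ⁻¹) • γ • z
  simp [smul_smul, -sl_moeb]

theorem mean_const_mul (c : ℂ) (φ : ℍ → ℂ) : mean Γ (fun z ↦ c * φ z) = c * mean Γ φ := by
  simp_rw [mean, average_eq, integral_const_mul, Complex.real_smul]
  ring

theorem mean_conj (φ : ℍ → ℂ) : mean Γ (fun z ↦ conj (φ z)) = conj (mean Γ φ) := by
  simp_rw [mean, average_eq, integral_conj, Complex.real_smul, map_mul, Complex.conj_ofReal]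

theorem mean_sum {ι : Type*} (s : Finset ι) {φ : ι → ℍ → ℂ} (hφ : ∀ i ∈ s, Measurable (φ i))
    (hb : ∀ i ∈ s, ∃ C, ∀ z, ‖φ i z‖ ≤ C) :
    mean Γ (fun z ↦ ∑ i ∈ s, φ i z) = ∑ i ∈ s, mean Γ (φ i) := by
  simp_rw [mean, average_eq]
  rw [integral_finsetSum, Finset.smul_sum]
  intro i hi
  obtain ⟨C, hC⟩ := hb i hi
  exact .of_bound (hφ i hi).aestronglyMeasurable C (.of_forall hC)

end Mean

/-! ### The Petersson product as a mean value -/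

section Petersson

open UpperHalfPlane ModularGroup

/-- Off the translates of the boundary lines, two representatives moving z into `fd` differ by a
sign; as -1 ∈ Γ₀(M), they represent the same coset. -/
theorem indicator_fundamentalDomain_ae (M : ℕ) [NeZero M] :
    (fundamentalDomain M).indicator (1 : ℍ → ℝ≥0∞) =ᵐ[volume]
      levelWeight (CongruenceSubgroup.Gamma0 M) := by
  filter_upwards [ae_smul_notMem_boundaryLines] with z hz
  by_cases h : ∃ q : SL(2, ℤ) ⧸ CongruenceSubgroup.Gamma0 M, q.out • z ∈ fd
  · obtain ⟨q, hq⟩ := h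
    rw [Set.indicator_of_mem (show z ∈ fundamentalDomain M from ⟨q, hq⟩), levelWeight,
      Finset.sum_eq_single q, Set.indicator_of_mem hq]
    · rfl
    · intro q' _ hne
      refine Set.indicator_of_notMem (fun hq' ↦ hne ?_) _
      have := eq_one_or_neg_one_of_mem_fd (g := q'.out * q.out⁻¹) (hz q.out) hq
        (by rwa [smul_smul, inv_mul_cancel_right])
      rw [← q'.out_eq', ← q.out_eq']
      refine QuotientGroup.eq.mpr ?_
      rcases this with h | h <;> rw [mul_inv_eq_iff_eq_mul] at h <;> rw [h]
      · simp
      · simp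
    · simp
  · rw [Set.indicator_of_notMem (show z ∉ fundamentalDomain M from h), levelWeight,
      Finset.sum_eq_zero]
    intro q _
    exact Set.indicator_of_notMem (fun hq ↦ h ⟨q, hq⟩) _

theorem measurableSet_fundamentalDomain (M : ℕ) [NeZero M] :
    MeasurableSet (fundamentalDomain M) := by
  have : fundamentalDomain M = ⋃ q : SL(2, ℤ) ⧸ CongruenceSubgroup.Gamma0 M,
      (q.out • ·) ⁻¹' fd := by
    ext z
    simp [fundamentalDomain]
  rw [this]
  exact .iUnion fun q ↦ measurable_const_smul q.out isClosed_fd.measurableSet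

theorem restrict_fundamentalDomain (M : ℕ) [NeZero M] :
    (volume : Measure ℍ).restrict (fundamentalDomain M) =
      volume.withDensity (levelWeight (CongruenceSubgroup.Gamma0 M)) := by
  rw [← withDensity_congr_ae (indicator_fundamentalDomain_ae M),
    withDensity_indicator (measurableSet_fundamentalDomain M), withDensity_one]

/-- The Petersson product is a mean value, up to the volume of the modular curve. -/
theorem petersson_eq_mean (M : ℕ) [NeZero M] (k : ℤ) (f g : ℍ → ℂ) :
    petersson M k f g = (volume fd).toReal *
      mean (CongruenceSubgroup.Gamma0 M) (UpperHalfPlane.petersson k g f) := by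
  have hv : (volume fd).toReal ≠ 0 :=
    ENNReal.toReal_ne_zero.mpr ⟨volume_fd_ne_zero, volume_fd_ne_top⟩
  rw [petersson, restrict_fundamentalDomain, mean, average_eq, measureReal_def, levelMeasure_univ,
    ENNReal.toReal_mul, ENNReal.toReal_natCast, Complex.real_smul]
  have hv' : ((volume fd).toReal : ℂ) ≠ 0 := mod_cast hv
  push_cast
  rw [mul_inv]
  field_simp

end Petersson

/-! ### The index of Γ₀(N) ∩ Γ⁰(n) in Γ₀(N) -/

section Index

open CongruenceSubgroup

/-- `F` separates exactly the left cosets of `H` in `K`. It serves to count both points of a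
projective line and cosets in a double coset. -/
theorem relIndex_eq_ncard_image {G T : Type*} [Group G] (H K : Subgroup G) (F : G → T)
    (hF : ∀ x ∈ K, ∀ y ∈ K, F x = F y ↔ x⁻¹ * y ∈ H) :
    H.relIndex K = (F '' K).ncard := by
  have hrel : ∀ x y : K, (QuotientGroup.leftRel (H.subgroupOf K)) x y ↔ F x = F y := fun x y ↦ by
    rw [QuotientGroup.leftRel_apply, Subgroup.mem_subgroupOf, hF x x.2 y y.2]
    rfl
  rw [Subgroup.relIndex, Subgroup.index, ← Nat.card_coe_set_eq]
  refine Nat.card_eq_of_bijective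
    (Quotient.lift (fun x : K ↦ (⟨F x, x, x.2, rfl⟩ : F '' K))
      fun x y h ↦ Subtype.ext ((hrel x y).mp h)) ⟨?_, ?_⟩
  · rintro ⟨x⟩ ⟨y⟩ h
    exact Quotient.sound ((hrel x y).mpr (congrArg Subtype.val h))
  · rintro ⟨_, x, hx, rfl⟩
    exact ⟨Quotient.mk _ ⟨x, hx⟩, rfl⟩

theorem SL_inv_mul_apply_zero_one (x y : SL(2, ℤ)) :
    (x⁻¹ * y) 0 1 = x 1 1 * y 0 1 - x 0 1 * y 1 1 := by
  rw [Matrix.SpecialLinearGroup.coe_mul, Matrix.mul_apply, Fin.sum_univ_two,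
    Matrix.SpecialLinearGroup.SL2_inv_expl]
  simp
  ring

/-- The group `Γ₀(N) ∩ Γ⁰(n)` of matrices `(a b; c d)` with `N ∣ c` and `n ∣ b`. -/
def Gamma00 (N n : ℕ) : Subgroup SL(2, ℤ) where
  carrier := {g | g ∈ Gamma0 N ∧ (n : ℤ) ∣ g 0 1}
  one_mem' := ⟨one_mem _, by simp⟩
  mul_mem' {x y} hx hy := by
    refine ⟨mul_mem hx.1 hy.1, ?_⟩
    rw [Matrix.SpecialLinearGroup.coe_mul, Matrix.mul_apply, Fin.sum_univ_two]
    exact dvd_add (hy.2.mul_left _) (hx.2.mul_right _)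
  inv_mem' {x} hx := by
    refine ⟨inv_mem hx.1, ?_⟩
    rw [Matrix.SpecialLinearGroup.SL2_inv_expl]
    simpa using hx.2

theorem mem_Gamma00 {N n : ℕ} {g : SL(2, ℤ)} :
    g ∈ Gamma00 N n ↔ (N : ℤ) ∣ g 1 0 ∧ (n : ℤ) ∣ g 0 1 := by
  rw [← ZMod.intCast_zmod_eq_zero_iff_dvd (g 1 0)]
  rfl

theorem Gamma00_le_Gamma0 (N n : ℕ) : Gamma00 N n ≤ Gamma0 N := fun _ h ↦ h.1

theorem Gamma00_one (N : ℕ) : Gamma00 N 1 = Gamma0 N :=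
  le_antisymm (Gamma00_le_Gamma0 N 1) fun _ h ↦ ⟨h, by simp⟩

theorem Gamma00_le_of_dvd (N : ℕ) {n m : ℕ} (h : n ∣ m) : Gamma00 N m ≤ Gamma00 N n :=
  fun _ hg ↦ ⟨hg.1, (Int.natCast_dvd_natCast.mpr h).trans hg.2⟩

theorem Gamma00_inf {N n m : ℕ} (h : n.Coprime m) :
    Gamma00 N n ⊓ Gamma00 N m = Gamma00 N (n * m) := by
  refine le_antisymm (fun g hg ↦ ⟨hg.1.1, ?_⟩) (le_inf (Gamma00_le_of_dvd N ⟨m, rfl⟩)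
    (Gamma00_le_of_dvd N ⟨n, mul_comm _ _⟩))
  push_cast
  exact (Nat.isCoprime_iff_coprime.mpr h).mul_dvd hg.1.2 hg.2.2

theorem Gamma_le_Gamma00 {N n L : ℕ} (hN : N ∣ L) (hn : n ∣ L) : Gamma L ≤ Gamma00 N n := by
  intro g hg
  rw [Gamma_mem] at hg
  simp only [ZMod.intCast_zmod_eq_zero_iff_dvd] at hg
  exact mem_Gamma00.mpr ⟨(Int.natCast_dvd_natCast.mpr hN).trans hg.2.2.1,
    (Int.natCast_dvd_natCast.mpr hn).trans hg.2.1⟩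

instance (N n : ℕ) [NeZero N] [NeZero n] : (Gamma00 N n).FiniteIndex :=
  Subgroup.finiteIndex_of_le (Gamma_le_Gamma00 (Dvd.intro n rfl) (Dvd.intro_left N rfl))

theorem det_eq (g : SL(2, ℤ)) : g 0 0 * g 1 1 - g 0 1 * g 1 0 = 1 := by
  rw [← Matrix.det_fin_two, g.det_coe]

open Classical in
/-- The point `[b / n : d]` of the projective line over `ZMod p`. -/
noncomputable def projPoint (n p : ℕ) (g : SL(2, ℤ)) : Option (ZMod p) :=
  if (g 1 1 : ZMod p) = 0 then none else some ((g 0 1 / n : ℤ) * (g 1 1 : ZMod p)⁻¹)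

/-- With b = nβ, the upper right entry of x⁻¹y is n(d_x β_y - β_x d_y), so the condition is
proportionality of (β, d) mod p. The determinant excludes β ≡ d ≡ 0. -/
theorem projPoint_eq_iff {N n p : ℕ} [Fact p.Prime] (hn : n ≠ 0) {x y : SL(2, ℤ)}
    (hx : x ∈ Gamma00 N n) (hy : y ∈ Gamma00 N n) :
    projPoint n p x = projPoint n p y ↔ x⁻¹ * y ∈ Gamma00 N (n * p) := by
  obtain ⟨β, hβ⟩ := hx.2
  obtain ⟨β', hβ'⟩ := hy.2
  have hn' : (n : ℤ) ≠ 0 := mod_cast hn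
  have hmem : x⁻¹ * y ∈ Gamma00 N (n * p) ↔
      (x 1 1 : ZMod p) * β' - β * (y 1 1 : ZMod p) = 0 := by
    have h1 : (x⁻¹ * y) 0 1 = n * (x 1 1 * β' - β * y 1 1) := by
      rw [SL_inv_mul_apply_zero_one, hβ, hβ']
      ring
    have h2 : x⁻¹ * y ∈ Gamma00 N (n * p) ↔ ((n * p : ℕ) : ℤ) ∣ (x⁻¹ * y) 0 1 :=
      ⟨fun h ↦ h.2, fun h ↦ ⟨mul_mem (inv_mem hx.1) hy.1, h⟩⟩
    rw [h2, h1, Nat.cast_mul, mul_dvd_mul_iff_left hn', ← ZMod.intCast_zmod_eq_zero_iff_dvd]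
    push_cast
    rfl
  have hdet : ∀ (z : SL(2, ℤ)) (γ : ℤ), z 0 1 = n * γ → (z 1 1 : ZMod p) = 0 →
      (γ : ZMod p) ≠ 0 := by
    intro z γ hγ hz h0
    have := congrArg (Int.cast : ℤ → ZMod p) (det_eq z)
    rw [hγ] at this
    push_cast at this
    simp [hz, h0] at this
  have hdx := hdet x β hβ
  have hdy := hdet y β' hβ'
  rw [hmem]
  unfold projPoint
  rw [hβ, hβ', Int.mul_ediv_cancel_left _ hn', Int.mul_ediv_cancel_left _ hn']
  by_cases h1 : (x 1 1 : ZMod p) = 0 <;> by_cases h2 : (y 1 1 : ZMod p) = 0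
  · simp [h1, h2]
  · simpa [h1, h2] using hdx h1
  · simpa [h1, h2] using hdy h2
  · simp only [h1, h2, if_false, Option.some.injEq]
    rw [← div_eq_mul_inv, ← div_eq_mul_inv, div_eq_div_iff h1 h2, sub_eq_zero]
    constructor <;> intro h <;> linear_combination -h

theorem some_mem_projPoint_image (N : ℕ) {n p : ℕ} [Fact p.Prime] (hn : n ≠ 0) (t : ZMod p) :
    some t ∈ projPoint n p '' Gamma00 N n := by
  have hn' : (n : ℤ) ≠ 0 := mod_cast hn
  obtain ⟨j, rfl⟩ := ZMod.intCast_surjective t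
  refine ⟨⟨!![1, n * j; 0, 1], by simp⟩, mem_Gamma00.mpr (by simp), ?_⟩
  simp [projPoint, Int.mul_ediv_cancel_left _ hn']

/-- Here p divides Nn and hence bc, so ad ≡ 1 mod p and d is invertible. -/
theorem projPoint_ne_none {N n p : ℕ} [Fact p.Prime] (hp : p ∣ N * n) {g : SL(2, ℤ)}
    (hg : g ∈ Gamma00 N n) : projPoint n p g ≠ none := by
  intro h
  have h11 : (g 1 1 : ZMod p) = 0 := by
    by_contra h'
    simp [projPoint, h'] at h
  have h1 := congrArg (Int.cast : ℤ → ZMod p) (det_eq g)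
  push_cast at h1
  have h2 : ((g 0 1 * g 1 0 : ℤ) : ZMod p) = 0 := by
    rw [ZMod.intCast_zmod_eq_zero_iff_dvd]
    have := mul_dvd_mul (mem_Gamma00.mp hg).1 (mem_Gamma00.mp hg).2
    rw [mul_comm (g 0 1)]
    exact (by exact_mod_cast hp : (p : ℤ) ∣ N * n).trans this
  push_cast at h2
  simp [h11, h2] at h1

theorem none_mem_projPoint_image {N n p : ℕ} [hp : Fact p.Prime] (hpN : ¬ p ∣ N * n) :
    none ∈ projPoint n p '' Gamma00 N n := by
  have hc : IsCoprime (p : ℤ) ((N * n : ℕ) : ℤ) :=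
    Nat.isCoprime_iff_coprime.mpr ((Nat.Prime.coprime_iff_not_dvd hp.out).mpr hpN)
  obtain ⟨u, v, huv⟩ := hc
  -- The Bézout relation up + vNn = 1 is the determinant; the entry d = p gives the point at
  -- infinity.
  refine ⟨⟨!![u, -(n * v); N, p], ?_⟩, mem_Gamma00.mpr (by simp), ?_⟩
  · rw [Matrix.det_fin_two_of, ← huv]
    push_cast
    ring
  · simp [projPoint]

/-- Cosets correspond to the points [b/n : d] that occur: only the affine line if p ∣ Nn, the whole
projective line over `ZMod p` otherwise. -/
theorem relIndex_Gamma00_mul_prime (N : ℕ) {n p : ℕ} (hp : p.Prime) (hn : n ≠ 0) :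
    (Gamma00 N (n * p)).relIndex (Gamma00 N n) = if p ∣ N * n then p else p + 1 := by
  have : Fact p.Prime := ⟨hp⟩
  rw [relIndex_eq_ncard_image _ _ (projPoint n p) fun x hx y hy ↦ projPoint_eq_iff hn hx hy]
  split_ifs with h
  · have : projPoint n p '' Gamma00 N n = Set.range some := by
      ext t
      constructor
      · rintro ⟨g, hg, rfl⟩
        obtain ⟨t, ht⟩ := Option.ne_none_iff_exists.mp (projPoint_ne_none h hg)
        exact ⟨t, ht⟩
      · rintro ⟨t, rfl⟩
        exact some_mem_projPoint_image N hn t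
    rw [this, ← Set.image_univ, Set.ncard_image_of_injective _ (Option.some_injective _),
      Set.ncard_univ, Nat.card_zmod]
  · have : projPoint n p '' Gamma00 N n = Set.univ := by
      ext t
      simp only [Set.mem_univ, iff_true]
      cases t with
      | none => exact none_mem_projPoint_image h
      | some t => exact some_mem_projPoint_image N hn t
    rw [this, Set.ncard_univ, Finite.card_option, Nat.card_zmod]

/-- The index of `Γ₀(N) ∩ Γ⁰(n)` in `Γ₀(N)`. -/
theorem relIndex_Gamma00 (N : ℕ) {n : ℕ} (hn : n ≠ 0) :
    ((Gamma00 N n).relIndex (Gamma0 N) : ℂ) =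
      n * ∏ p ∈ n.primeFactors with ¬ p ∣ N, (1 + 1 / (p : ℂ)) := by
  induction n using induction_on_primes with
  | zero => exact absurd rfl hn
  | one => simp [Gamma00_one]
  | prime_mul p a hp ih =>
    have ha : a ≠ 0 := right_ne_zero_of_mul hn
    have hp0 : (p : ℂ) ≠ 0 := mod_cast hp.ne_zero
    rw [mul_comm p a, ← Subgroup.relIndex_mul_relIndex _ _ _ (Gamma00_le_of_dvd N (Dvd.intro p rfl))
      (Gamma00_le_Gamma0 N a), Nat.cast_mul, ih ha, relIndex_Gamma00_mul_prime N hp ha,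
      Nat.primeFactors_mul ha hp.ne_zero, hp.primeFactors]
    -- A new factor 1 + 1/p appears exactly when p divides neither a nor N, which is when the step
    -- has index p + 1 = p(1 + 1/p).
    by_cases hpa : p ∣ a
    · rw [if_pos (hpa.mul_left N), Finset.union_eq_left.mpr]
      · push_cast
        ring
      · simpa using ⟨hp, hpa, ha⟩
    · have hpa' : p ∉ a.primeFactors := fun h ↦ hpa (Nat.dvd_of_mem_primeFactors h)
      rw [Finset.filter_union, Finset.filter_singleton]
      by_cases hpN : p ∣ N
      · simp [hpN, hpN.mul_right]
        ring
      · rw [if_neg (by simp [hp.dvd_mul, hpN, hpa]), if_pos hpN,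
          Finset.prod_union (by simp [hpa]), Finset.prod_singleton]
        push_cast
        field_simp

theorem relIndex_Gamma00_mul (N : ℕ) {n m : ℕ} (hn : n ≠ 0) (hm : m ≠ 0) (h : n.Coprime m) :
    (Gamma00 N (n * m)).relIndex (Gamma0 N) =
      (Gamma00 N n).relIndex (Gamma0 N) * (Gamma00 N m).relIndex (Gamma0 N) := by
  rw [← Nat.cast_inj (R := ℂ), Nat.cast_mul, relIndex_Gamma00 N (mul_ne_zero hn hm),
    relIndex_Gamma00 N hn, relIndex_Gamma00 N hm, h.primeFactors_mul, Finset.filter_union,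
    Finset.prod_union (Finset.disjoint_filter_filter h.disjoint_primeFactors)]
  push_cast
  ring

end Index

/-! ### Hecke matrices, right cosets and conjugation by diag(1, m) -/

section Hecke

open UpperHalfPlane CongruenceSubgroup Matrix.SpecialLinearGroup

/-- The matrix `diag(l, m)`. -/
noncomputable def diagGL (l m : ℕ) [NeZero l] [NeZero m] : GL (Fin 2) ℝ :=
  Matrix.GeneralLinearGroup.mkOfDetNeZero !![(l : ℝ), 0; 0, (m : ℝ)]
    (by simp [NeZero.ne])

theorem coe_diagGL (l m : ℕ) [NeZero l] [NeZero m] :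
    (diagGL l m : Matrix (Fin 2) (Fin 2) ℝ) = !![(l : ℝ), 0; 0, (m : ℝ)] := rfl

theorem det_diagGL_pos (l m : ℕ) [NeZero l] [NeZero m] : 0 < (diagGL l m).det.val := by
  rw [Matrix.GeneralLinearGroup.val_det_apply, coe_diagGL, Matrix.det_fin_two_of]
  simp [NeZero.pos]

theorem diagGL_one_one : diagGL 1 1 = 1 := by
  ext i j
  fin_cases i <;> fin_cases j <;> simp [coe_diagGL]

theorem mem_doubleCoset {N l m : ℕ} [NeZero l] [NeZero m] {β : GL (Fin 2) ℝ} :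
    β ∈ doubleCoset N l m ↔ ∃ γ₁ ∈ Gamma0 N, ∃ γ₂ ∈ Gamma0 N,
      β = mapGL ℝ γ₁ * diagGL l m * mapGL ℝ γ₂ := by
  have h : ∀ γ₁ γ₂ : SL(2, ℤ), ((γ₁ : Matrix (Fin 2) (Fin 2) ℤ) * !![(l : ℤ), 0; 0, (m : ℤ)] *
      (γ₂ : Matrix (Fin 2) (Fin 2) ℤ)).map (Int.cast : ℤ → ℝ) =
      ((mapGL ℝ γ₁ * diagGL l m * mapGL ℝ γ₂ : GL (Fin 2) ℝ) : Matrix (Fin 2) (Fin 2) ℝ) := by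
    intro γ₁ γ₂
    rw [Matrix.map_mul_intCast, Matrix.map_mul_intCast, Units.val_mul, Units.val_mul, coe_diagGL]
    congr 2
    ext i j
    fin_cases i <;> fin_cases j <;> simp
  simp only [doubleCoset, Set.mem_ofPred_eq, h, ← Units.ext_iff]

/-- The integral matrices of positive determinant with lower left entry divisible by `N`. -/
def IsHeckeMatrix (N : ℕ) (β : GL (Fin 2) ℝ) : Prop :=
  ∃ B : Matrix (Fin 2) (Fin 2) ℤ, (β : Matrix (Fin 2) (Fin 2) ℝ) = B.map (Int.cast : ℤ → ℝ) ∧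
    (N : ℤ) ∣ B 1 0 ∧ 0 < β.det.val

theorem IsHeckeMatrix.mul {N : ℕ} {α β : GL (Fin 2) ℝ} (hα : IsHeckeMatrix N α)
    (hβ : IsHeckeMatrix N β) : IsHeckeMatrix N (α * β) := by
  obtain ⟨A, hA, hAN, hAd⟩ := hα
  obtain ⟨B, hB, hBN, hBd⟩ := hβ
  refine ⟨A * B, ?_, ?_, ?_⟩
  · rw [Units.val_mul, hA, hB, Matrix.map_mul_intCast]
  · rw [Matrix.mul_apply, Fin.sum_univ_two]
    exact dvd_add (hAN.mul_right _) (hBN.mul_left _)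
  · rw [map_mul, Units.val_mul]
    exact mul_pos hAd hBd

theorem dvd_of_mem_Gamma0 {N : ℕ} {γ : SL(2, ℤ)} (hγ : γ ∈ Gamma0 N) : (N : ℤ) ∣ γ 1 0 := by
  rwa [← ZMod.intCast_zmod_eq_zero_iff_dvd, ← Gamma0_mem]

theorem Gamma0_le_of_dvd {N M : ℕ} (h : N ∣ M) : Gamma0 M ≤ Gamma0 N := fun γ hγ ↦ by
  rw [Gamma0_mem, ZMod.intCast_zmod_eq_zero_iff_dvd]
  exact (Int.natCast_dvd_natCast.mpr h).trans (dvd_of_mem_Gamma0 hγ)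

theorem mapGL_apply (γ : SL(2, ℤ)) (i j : Fin 2) : mapGL ℝ γ i j = (γ i j : ℝ) := rfl

theorem isHeckeMatrix_mapGL {N : ℕ} {γ : SL(2, ℤ)} (hγ : γ ∈ Gamma0 N) :
    IsHeckeMatrix N (mapGL ℝ γ) :=
  ⟨γ, rfl, dvd_of_mem_Gamma0 hγ, by simp⟩

theorem isHeckeMatrix_diagGL (N l m : ℕ) [NeZero l] [NeZero m] :
    IsHeckeMatrix N (diagGL l m) := by
  refine ⟨!![(l : ℤ), 0; 0, (m : ℤ)], ?_, by simp, det_diagGL_pos l m⟩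
  rw [coe_diagGL]
  ext i j
  fin_cases i <;> fin_cases j <;> simp

theorem isHeckeMatrix_of_mem_doubleCoset {N l m : ℕ} [NeZero l] [NeZero m] {β : GL (Fin 2) ℝ}
    (hβ : β ∈ doubleCoset N l m) : IsHeckeMatrix N β := by
  obtain ⟨γ₁, h₁, γ₂, h₂, rfl⟩ := mem_doubleCoset.mp hβ
  exact ((isHeckeMatrix_mapGL h₁).mul (isHeckeMatrix_diagGL N l m)).mul (isHeckeMatrix_mapGL h₂)

theorem slash_const_smul (k : ℤ) {β : GL (Fin 2) ℝ} (hβ : 0 < β.det.val) (f : ℍ → ℂ) (c : ℂ) :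
    (c • f) ∣[k] β = c • f ∣[k] β := by
  rw [ModularForm.smul_slash, σ, if_pos hβ]
  rfl

theorem char_mul_eq_one {N : ℕ} (χ : DirichletCharacter ℂ N) {γ : SL(2, ℤ)} (hγ : γ ∈ Gamma0 N) :
    χ ((γ 0 0 : ℤ) : ZMod N) * χ ((γ 1 1 : ℤ) : ZMod N) = 1 := by
  have h := congrArg (Int.cast : ℤ → ZMod N) (det_eq γ)
  push_cast at h
  rw [Gamma0_mem.mp hγ, mul_zero, sub_zero] at h
  rw [← map_mul, h, map_one]

/-- The summand of the Hecke operator that belongs to the matrix `β`. -/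
noncomputable def heckeTerm (N : ℕ) (k : ℤ) (χ : DirichletCharacter ℂ N) (f : ℍ → ℂ)
    (β : GL (Fin 2) ℝ) : ℍ → ℂ :=
  χ ((⌊β 0 0⌋ : ℤ) : ZMod N) • (f ∣[k] β)

/-- Functions on `ℍ` with `f ∣[k] γ = χ(d) f` for all `γ ∈ Γ₀(N)`. -/
def HasCharacter (N : ℕ) (k : ℤ) (χ : DirichletCharacter ℂ N) (f : ℍ → ℂ) : Prop :=
  ∀ γ : SL(2, ℤ), γ ∈ Gamma0 N → f ∣[k] γ = χ ((γ 1 1 : ℤ) : ZMod N) • f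

variable {N : ℕ} {k : ℤ} {χ : DirichletCharacter ℂ N} {f : ℍ → ℂ}

/-- Since N divides the lower left entry of `β`, the upper left entries multiply mod N; the
resulting χ(a_γ) cancels the χ(d_γ) from slashing `f`. -/
theorem heckeTerm_mapGL_mul (hf : HasCharacter N k χ f) {γ : SL(2, ℤ)} (hγ : γ ∈ Gamma0 N)
    {β : GL (Fin 2) ℝ} (hβ : IsHeckeMatrix N β) :
    heckeTerm N k χ f (mapGL ℝ γ * β) = heckeTerm N k χ f β := by
  obtain ⟨B, hB, hBN, hBd⟩ := hβ
  have h₁ : (mapGL ℝ γ * β) 0 0 = ((γ 0 0 * B 0 0 + γ 0 1 * B 1 0 : ℤ) : ℝ) := by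
    rw [Units.val_mul, hB, Matrix.mul_apply, Fin.sum_univ_two]
    simp
  have h₂ : β 0 0 = ((B 0 0 : ℤ) : ℝ) := by rw [hB]; rfl
  have h₃ : ((B 1 0 : ℤ) : ZMod N) = 0 := (ZMod.intCast_zmod_eq_zero_iff_dvd _ _).mpr hBN
  have h₄ : f ∣[k] (mapGL ℝ γ) = χ ((γ 1 1 : ℤ) : ZMod N) • f := hf γ hγ
  rw [heckeTerm, heckeTerm, h₁, h₂, Int.floor_intCast, Int.floor_intCast, SlashAction.slash_mul,
    h₄, slash_const_smul k hBd, smul_smul]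
  push_cast
  rw [h₃, mul_zero, add_zero, map_mul, mul_right_comm, char_mul_eq_one χ hγ, one_mul]

/-- The set of right cosets of `Γ₀(N)` in `GL(2, ℝ)`. -/
abbrev RightCosets (N : ℕ) : Type :=
  Quotient (QuotientGroup.rightRel ((Gamma0 N : Subgroup SL(2, ℤ)) : Subgroup (GL (Fin 2) ℝ)))

/-- The right coset `Γ₀(N) β`. -/
def rightCoset (N : ℕ) (β : GL (Fin 2) ℝ) : RightCosets N := Quotient.mk _ β

theorem rightCoset_eq_iff {α β : GL (Fin 2) ℝ} :
    rightCoset N α = rightCoset N β ↔ ∃ γ ∈ Gamma0 N, β = mapGL ℝ γ * α := by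
  rw [rightCoset, rightCoset, Quotient.eq, QuotientGroup.rightRel_apply, Subgroup.mem_map]
  simp only [mul_inv_eq_iff_eq_mul, eq_comm (b := β * α⁻¹)]

theorem heckeTerm_out (hf : HasCharacter N k χ f) {β : GL (Fin 2) ℝ} (hβ : IsHeckeMatrix N β) :
    heckeTerm N k χ f (rightCoset N β).out = heckeTerm N k χ f β := by
  obtain ⟨γ, hγ, h⟩ := rightCoset_eq_iff.mp
    (show rightCoset N β = rightCoset N (rightCoset N β).out from (Quotient.out_eq _).symm)
  rw [h, heckeTerm_mapGL_mul hf hγ hβ]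

theorem heckeT_eq (N : ℕ) (k : ℤ) (χ : DirichletCharacter ℂ N) (l m : ℕ) (f : ℍ → ℂ) :
    heckeT N k χ l m f =
      ∑ᶠ q ∈ rightCoset N '' doubleCoset N l m, heckeTerm N k χ f q.out := rfl

/-- Conjugation by `diag(1, m)`: the matrix `(a b; c d)` goes to `(a b/m; mc d)`. -/
def conjDiag (m : ℕ) (γ : SL(2, ℤ)) (h : (m : ℤ) ∣ γ 0 1) : SL(2, ℤ) :=
  ⟨!![γ 0 0, γ 0 1 / m; m * γ 1 0, γ 1 1], by
    rw [Matrix.det_fin_two_of, ← mul_assoc, Int.ediv_mul_cancel h, det_eq]⟩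

theorem diagGL_mul_mapGL (m : ℕ) [NeZero m] (γ : SL(2, ℤ)) (h : (m : ℤ) ∣ γ 0 1) :
    diagGL 1 m * mapGL ℝ γ = mapGL ℝ (conjDiag m γ h) * diagGL 1 m := by
  obtain ⟨b, hb⟩ := h
  ext i j
  rw [Units.val_mul, Units.val_mul, Matrix.mul_apply, Matrix.mul_apply, coe_diagGL]
  simp only [Fin.sum_univ_two, mapGL_apply]
  fin_cases i <;> fin_cases j <;>
    simp [conjDiag, hb, mul_comm]

theorem conjDiag_mem_Gamma0 {m : ℕ} {γ : SL(2, ℤ)} (hγ : γ ∈ Gamma00 N m) :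
    conjDiag m γ hγ.2 ∈ Gamma0 (N * m) := by
  rw [Gamma0_mem, ZMod.intCast_zmod_eq_zero_iff_dvd]
  obtain ⟨c, hc⟩ := (mem_Gamma00.mp hγ).1
  refine ⟨c, ?_⟩
  simp [conjDiag, hc]
  ring

/-- Conjugating (a b; c d) by diag(1, m) gives (a b/m; mc d), which is integral exactly when m ∣ b.
-/
theorem rightCoset_diagGL_mul_eq_iff {m : ℕ} [NeZero m] {x y : SL(2, ℤ)} (hx : x ∈ Gamma0 N)
    (hy : y ∈ Gamma0 N) :
    rightCoset N (diagGL 1 m * mapGL ℝ x) = rightCoset N (diagGL 1 m * mapGL ℝ y) ↔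
      y * x⁻¹ ∈ Gamma00 N m := by
  rw [rightCoset_eq_iff]
  constructor
  · rintro ⟨γ, hγ, h⟩
    refine ⟨mul_mem hy (inv_mem hx), γ 0 1, ?_⟩
    rw [← mul_assoc, ← mul_inv_eq_iff_eq_mul, mul_assoc, ← map_inv, ← map_mul] at h
    have h' := congrArg (fun g : GL (Fin 2) ℝ ↦ g 0 1) h
    simp only [Units.val_mul, Matrix.mul_apply, coe_diagGL, Fin.sum_univ_two, mapGL_apply] at h'
    simp only [Nat.cast_one, Matrix.of_apply, Matrix.cons_val', Matrix.cons_val_zero,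
      Matrix.cons_val_fin_one, one_mul, Matrix.cons_val_one, zero_mul, add_zero, mul_zero,
      zero_add] at h'
    rw [mul_comm (m : ℤ)]
    exact_mod_cast h'
  · intro h
    refine ⟨_, Gamma0_le_of_dvd (Dvd.intro m rfl) (conjDiag_mem_Gamma0 h), ?_⟩
    rw [← mul_assoc, ← diagGL_mul_mapGL, mul_assoc, ← map_mul, inv_mul_cancel_right]

end Hecke

/-! ### Counting cosets and choosing representatives -/

section Cosets

open UpperHalfPlane CongruenceSubgroup Matrix.SpecialLinearGroup

variable {N : ℕ} {k : ℤ} {χ : DirichletCharacter ℂ N} {f : ℍ → ℂ}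

/-- The cosets `Γ₀(N) diag(1, m) γ` with `γ` in a subgroup `K` of `Γ₀(N)` are counted by an index. -/
theorem ncard_rightCoset_image (m : ℕ) [NeZero m] {K : Subgroup SL(2, ℤ)} (hK : K ≤ Gamma0 N) :
    ((fun γ : SL(2, ℤ) ↦ rightCoset N (diagGL 1 m * mapGL ℝ γ)) '' K).ncard =
      (Gamma00 N m).relIndex K := by
  -- Inversion converts the right cosets at hand into the left cosets behind `relIndex`.
  rw [relIndex_eq_ncard_image (Gamma00 N m) K
    (fun γ ↦ rightCoset N (diagGL 1 m * mapGL ℝ γ⁻¹))]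
  · congr 1
    ext q
    constructor <;> rintro ⟨γ, hγ, rfl⟩ <;> exact ⟨γ⁻¹, inv_mem hγ, by simp⟩
  · intro x hx y hy
    rw [rightCoset_diagGL_mul_eq_iff (inv_mem (hK hx)) (inv_mem (hK hy)), inv_inv,
      ← inv_mem_iff, mul_inv_rev, inv_inv]

theorem rightCoset_image_doubleCoset (N m : ℕ) [NeZero m] :
    rightCoset N '' doubleCoset N 1 m =
      (fun γ : SL(2, ℤ) ↦ rightCoset N (diagGL 1 m * mapGL ℝ γ)) '' Gamma0 N := by
  ext q
  constructor
  · rintro ⟨β, hβ, rfl⟩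
    obtain ⟨γ₁, h₁, γ₂, h₂, rfl⟩ := mem_doubleCoset.mp hβ
    exact ⟨γ₂, h₂, rightCoset_eq_iff.mpr ⟨γ₁, h₁, mul_assoc _ _ _⟩⟩
  · rintro ⟨γ, hγ, rfl⟩
    exact ⟨_, mem_doubleCoset.mpr ⟨1, one_mem _, γ, hγ, by simp⟩, rfl⟩

theorem ncard_rightCoset_image_doubleCoset (N m : ℕ) [NeZero m] :
    (rightCoset N '' doubleCoset N 1 m).ncard = (Gamma00 N m).relIndex (Gamma0 N) := by
  rw [rightCoset_image_doubleCoset, ncard_rightCoset_image m le_rfl]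

theorem relIndex_Gamma00_ne_zero (N m : ℕ) [NeZero N] [NeZero m] :
    (Gamma00 N m).relIndex (Gamma0 N) ≠ 0 :=
  Subgroup.FiniteIndex.index_ne_zero

theorem finite_rightCoset_image_doubleCoset (N m : ℕ) [NeZero N] [NeZero m] :
    (rightCoset N '' doubleCoset N 1 m).Finite :=
  Set.finite_of_ncard_ne_zero
    (by rw [ncard_rightCoset_image_doubleCoset]; exact relIndex_Gamma00_ne_zero N m)

/-- If `n` and `m` are coprime, the cosets in `Γ₀(N) diag(1, n) Γ₀(N)` have representatives
`diag(1, n) γ` with `γ` in `Γ₀(N) ∩ Γ⁰(m)`. -/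
theorem rightCoset_image_doubleCoset_of_coprime (N : ℕ) {n m : ℕ} [NeZero N] [NeZero n] [NeZero m]
    (h : n.Coprime m) :
    rightCoset N '' doubleCoset N 1 n =
      (fun γ : SL(2, ℤ) ↦ rightCoset N (diagGL 1 n * mapGL ℝ γ)) '' Gamma00 N m := by
  symm
  -- The representatives in Γ₀(N) ∩ Γ⁰(m) give a subset with [Γ₀(N) ∩ Γ⁰(m) : Γ₀(N) ∩ Γ⁰(nm)]
  -- elements; by multiplicativity of the index this is already the full number of cosets.
  refine Set.eq_of_subset_of_ncard_le ?_ ?_ (finite_rightCoset_image_doubleCoset N n)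
  · rw [rightCoset_image_doubleCoset]
    exact Set.image_mono (Gamma00_le_Gamma0 N m)
  · rw [ncard_rightCoset_image_doubleCoset, ncard_rightCoset_image n (Gamma00_le_Gamma0 N m),
      ← Subgroup.inf_relIndex_right (Gamma00 N n) (Gamma00 N m), Gamma00_inf h]
    have h₁ := Subgroup.relIndex_mul_relIndex _ _ _
      (Gamma00_le_of_dvd N (Dvd.intro_left n rfl : m ∣ n * m)) (Gamma00_le_Gamma0 N m)
    rw [relIndex_Gamma00_mul N (NeZero.ne n) (NeZero.ne m) h] at h₁
    exact (Nat.mul_right_cancel (Nat.pos_of_ne_zero (relIndex_Gamma00_ne_zero N m)) h₁).ge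

end Cosets

/-! ### From eigenfunctions of T(n) to eigenfunctions of T(1, n) -/

section Eigenvalues

open UpperHalfPlane CongruenceSubgroup Matrix.SpecialLinearGroup

variable {N : ℕ} {k : ℤ} {χ : DirichletCharacter ℂ N} {f : ℍ → ℂ}

theorem diagGL_mul_right (l m : ℕ) [NeZero l] [NeZero m] [NeZero (l * m)] :
    diagGL l (l * m) = diagGL l l * diagGL 1 m := by
  ext i j
  rw [Units.val_mul, coe_diagGL, coe_diagGL, coe_diagGL, Matrix.mul_apply, Fin.sum_univ_two]
  fin_cases i <;> fin_cases j <;> simp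

theorem diagGL_self_mul_comm (l : ℕ) [NeZero l] (β : GL (Fin 2) ℝ) :
    diagGL l l * β = β * diagGL l l := by
  ext i j
  rw [Units.val_mul, Units.val_mul, coe_diagGL, Matrix.mul_apply, Matrix.mul_apply,
    Fin.sum_univ_two, Fin.sum_univ_two]
  fin_cases i <;> fin_cases j <;> simp [mul_comm]

theorem mem_doubleCoset_mul_iff {l m : ℕ} [NeZero l] [NeZero m] {β : GL (Fin 2) ℝ} :
    β ∈ doubleCoset N l (l * m) ↔ ∃ α ∈ doubleCoset N 1 m, β = diagGL l l * α := by
  simp only [mem_doubleCoset, diagGL_mul_right]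
  constructor
  · rintro ⟨γ₁, h₁, γ₂, h₂, rfl⟩
    refine ⟨_, ⟨γ₁, h₁, γ₂, h₂, rfl⟩, ?_⟩
    simp only [← mul_assoc, diagGL_self_mul_comm l (mapGL ℝ γ₁)]
  · rintro ⟨_, ⟨γ₁, h₁, γ₂, h₂, rfl⟩, rfl⟩
    refine ⟨γ₁, h₁, γ₂, h₂, ?_⟩
    simp only [← mul_assoc, diagGL_self_mul_comm l (mapGL ℝ γ₁)]

theorem slash_diagGL_apply (k : ℤ) (f : ℍ → ℂ) (l m : ℕ) [NeZero l] [NeZero m] (z : ℍ) :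
    (f ∣[k] diagGL l m) z =
      f (diagGL l m • z) * ((l : ℂ) * m) ^ (k - 1) * (m : ℂ) ^ (-k) := by
  have hdet : (diagGL l m).det.val = (l : ℝ) * m := by
    rw [Matrix.GeneralLinearGroup.val_det_apply, coe_diagGL, Matrix.det_fin_two_of]
    simp
  have hσ : σ (diagGL l m) (f (diagGL l m • z)) = f (diagGL l m • z) := by
    rw [σ, if_pos (det_diagGL_pos l m)]
    rfl
  have hdenom : denom (diagGL l m) z = m := by
    simp [denom, coe_diagGL]
  rw [ModularForm.slash_apply, hσ, hdenom, hdet, abs_of_nonneg (by positivity)]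
  push_cast
  rfl

theorem diagGL_self_smul (l : ℕ) [NeZero l] (z : ℍ) : diagGL l l • z = z := by
  have hl : (l : ℂ) ≠ 0 := mod_cast NeZero.ne l
  ext
  rw [coe_smul_of_det_pos (det_diagGL_pos l l)]
  simp [num, denom, coe_diagGL, hl]

theorem slash_diagGL_self (k : ℤ) (f : ℍ → ℂ) (l : ℕ) [NeZero l] :
    f ∣[k] diagGL l l = ((l : ℂ) ^ (k - 2)) • f := by
  have hl : (l : ℂ) ≠ 0 := mod_cast NeZero.ne l
  ext z
  rw [slash_diagGL_apply, diagGL_self_smul, mul_assoc, mul_zpow, ← zpow_add₀ hl, ← zpow_add₀ hl,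
    Pi.smul_apply, smul_eq_mul, mul_comm]
  congr 2
  ring

theorem heckeTerm_diagGL_self_mul (l : ℕ) [NeZero l] {β : GL (Fin 2) ℝ} (hβ : IsHeckeMatrix N β) :
    heckeTerm N k χ f (diagGL l l * β) =
      (χ (l : ZMod N) * (l : ℂ) ^ (k - 2)) • heckeTerm N k χ f β := by
  obtain ⟨B, hB, hBN, hBd⟩ := hβ
  have h₁ : (diagGL l l * β) 0 0 = ((l * B 0 0 : ℤ) : ℝ) := by
    rw [Units.val_mul, hB, coe_diagGL, Matrix.mul_apply, Fin.sum_univ_two]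
    simp
  have h₂ : β 0 0 = ((B 0 0 : ℤ) : ℝ) := by rw [hB]; rfl
  rw [heckeTerm, heckeTerm, h₁, h₂, Int.floor_intCast, Int.floor_intCast, SlashAction.slash_mul,
    slash_diagGL_self, slash_const_smul k hBd, smul_smul, smul_smul]
  push_cast
  rw [map_mul]
  congr 1
  ring

theorem diagGL_self_rightCoset_eq_iff (l : ℕ) [NeZero l] {α β : GL (Fin 2) ℝ} :
    rightCoset N (diagGL l l * α) = rightCoset N (diagGL l l * β) ↔
      rightCoset N α = rightCoset N β := by
  simp only [rightCoset_eq_iff, ← mul_assoc, ← diagGL_self_mul_comm l (mapGL ℝ _)]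
  simp only [mul_assoc, mul_right_inj]

/-- diag(l, lm) is diag(1, m) times the central scalar matrix l, so the cosets correspond; the
scalar contributes χ(l) and l^(2(k-1)) l^(-k) = l^(k-2). -/
theorem heckeT_mul_right (hf : HasCharacter N k χ f) (l m : ℕ) [NeZero N] [NeZero l] [NeZero m] :
    heckeT N k χ l (l * m) f = (χ (l : ZMod N) * (l : ℂ) ^ (k - 2)) • heckeT N k χ 1 m f := by
  rw [heckeT_eq, heckeT_eq, smul_finsum_mem (finite_rightCoset_image_doubleCoset N m)]
  symm
  refine finsum_mem_eq_of_bijOn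
    (Quotient.lift (fun β ↦ rightCoset N (diagGL l l * β))
      fun α β h ↦ (diagGL_self_rightCoset_eq_iff l).mpr (Quotient.sound h)) ⟨?_, ?_, ?_⟩ ?_
  · rintro _ ⟨β, hβ, rfl⟩
    exact ⟨_, mem_doubleCoset_mul_iff.mpr ⟨β, hβ, rfl⟩, rfl⟩
  · rintro _ ⟨α, hα, rfl⟩ _ ⟨β, hβ, rfl⟩ h
    exact (diagGL_self_rightCoset_eq_iff l).mp h
  · rintro _ ⟨β, hβ, rfl⟩
    obtain ⟨α, hα, rfl⟩ := mem_doubleCoset_mul_iff.mp hβ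
    exact ⟨_, ⟨α, hα, rfl⟩, rfl⟩
  · rintro _ ⟨β, hβ, rfl⟩
    have hβ' := isHeckeMatrix_of_mem_doubleCoset hβ
    rw [heckeTerm_out hf hβ', ← heckeTerm_diagGL_self_mul l hβ',
      ← heckeTerm_out hf ((isHeckeMatrix_diagGL N l l).mul hβ')]
    rfl

/-- An eigenfunction of all `T(n)` is an eigenfunction of all `T(1, n)`. -/
theorem exists_heckeT_one_eq_smul [NeZero N] (hf : HasCharacter N k χ f)
    (h : ∀ n : ℕ, 0 < n → ∃ c : ℂ, heckeTn N k χ n f = c • f) (n : ℕ) (hn : 0 < n) :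
    ∃ c : ℂ, heckeT N k χ 1 n f = c • f := by
  induction n using Nat.strong_induction_on with
  | _ n ih =>
    suffices hspan : heckeT N k χ 1 n f ∈ Submodule.span ℂ {f} by
      obtain ⟨c, hc⟩ := Submodule.mem_span_singleton.mp hspan
      exact ⟨c, hc.symm⟩
    obtain ⟨c, hc⟩ := h n hn
    -- T(1, n) is split off from T(n). The other terms are T(l, lr) with l²r = n and l > 1, hence
    -- multiples of T(1, r) with r < n.
    have hmem : (1, n) ∈ n.divisorsAntidiagonal.filter (fun x ↦ x.1 ∣ x.2) := by
      simp [hn.ne']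
    rw [heckeTn, ← Finset.add_sum_erase _ _ hmem, ← eq_sub_iff_add_eq] at hc
    rw [hc]
    refine sub_mem (Submodule.smul_mem _ _ (Submodule.mem_span_singleton_self f))
      (sum_mem ?_)
    rintro ⟨l, m⟩ hx
    simp only [Finset.mem_erase, Finset.mem_filter, Nat.mem_divisorsAntidiagonal, ne_eq,
      Prod.mk.injEq] at hx
    obtain ⟨hne, ⟨hlm, -⟩, r, rfl⟩ := hx
    have hl : l ≠ 0 := by rintro rfl; simp at hlm; omega
    have hr : r ≠ 0 := by rintro rfl; simp at hlm; omega
    have hl1 : l ≠ 1 := by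
      rintro rfl
      exact hne ⟨rfl, by simpa using hlm⟩
    have : NeZero l := ⟨hl⟩
    have : NeZero r := ⟨hr⟩
    have hlt : r < n := by
      rw [← hlm, ← mul_assoc]
      refine lt_mul_of_one_lt_left (Nat.pos_of_ne_zero hr) ?_
      have : 2 ≤ l := by omega
      nlinarith
    obtain ⟨c', hc'⟩ := ih r hlt (Nat.pos_of_ne_zero hr)
    rw [heckeT_mul_right hf, hc']
    exact Submodule.smul_mem _ _ (Submodule.smul_mem _ _ (Submodule.mem_span_singleton_self f))

end Eigenvalues

/-! ### The Petersson pairing on Γ(L) -/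

section Pairing

open UpperHalfPlane CongruenceSubgroup Matrix.SpecialLinearGroup

instance (L : ℕ) : (Gamma L).Normal := Gamma_normal L

/-- This reduces boundedness of mixed products to the diagonal ones. -/
theorem petersson_norm_sq (k : ℤ) (F G : ℍ → ℂ) (z : ℍ) :
    ‖UpperHalfPlane.petersson k G F z‖ ^ 2 =
      ‖UpperHalfPlane.petersson k G G z‖ * ‖UpperHalfPlane.petersson k F F z‖ := by
  simp only [UpperHalfPlane.petersson, norm_mul, RCLike.norm_conj]
  ring

theorem petersson_smul_smul (k : ℤ) (F G : ℍ → ℂ) (a b : ℂ) (z : ℍ) :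
    UpperHalfPlane.petersson k (b • G) (a • F) z =
      conj b * a * UpperHalfPlane.petersson k G F z := by
  simp only [UpperHalfPlane.petersson, Pi.smul_apply, smul_eq_mul, map_mul]
  ring

theorem petersson_sum_right (k : ℤ) (G : ℍ → ℂ) {ι : Type*} (s : Finset ι) (F : ι → ℍ → ℂ) :
    UpperHalfPlane.petersson k G (∑ i ∈ s, F i) =
      fun z ↦ ∑ i ∈ s, UpperHalfPlane.petersson k G (F i) z := by
  ext z
  simp only [UpperHalfPlane.petersson, Finset.sum_apply, Finset.mul_sum, Finset.sum_mul]

theorem continuous_slash (k : ℤ) {F : ℍ → ℂ} (hF : Continuous F) (g : GL (Fin 2) ℝ) :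
    Continuous (F ∣[k] g) := by
  have hd : Continuous fun z : ℍ ↦ denom g z := by
    unfold denom
    fun_prop
  rw [ModularForm.slash_def]
  refine .mul (.mul ((σ g).continuous.comp (hF.comp (continuous_const_smul g))) continuous_const) ?_
  exact hd.zpow₀ _ fun z ↦ .inl (denom_ne_zero g z)

/-- Continuous functions of weight `k` on `Γ(L)` of at most the growth of cusp forms. -/
structure IsCuspidal (L : ℕ) (k : ℤ) (F : ℍ → ℂ) : Prop where
  continuous : Continuous F
  slash_eq : ∀ γ ∈ Gamma L, F ∣[k] (γ : SL(2, ℤ)) = F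
  bounded : ∃ C, ∀ z, ‖UpperHalfPlane.petersson k F F z‖ ≤ C

variable {L : ℕ} {k : ℤ} {F G : ℍ → ℂ}

theorem exists_petersson_slash_bound {F : ℍ → ℂ}
    (h : ∃ C, ∀ z, ‖UpperHalfPlane.petersson k F F z‖ ≤ C) (g : GL (Fin 2) ℝ) :
    ∃ C, ∀ z, ‖UpperHalfPlane.petersson k (F ∣[k] g) (F ∣[k] g) z‖ ≤ C := by
  obtain ⟨C, hC⟩ := h
  refine ⟨‖((|g.det.val| : ℝ) : ℂ) ^ (k - 2)‖ * C, fun z ↦ ?_⟩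
  rw [petersson_slash, norm_mul, norm_σ]
  gcongr
  exact hC _

/-- Normality of Γ(L) is what allows slashing by all of SL(2, ℤ); this is why the pairing is taken
at a principal congruence subgroup. -/
theorem IsCuspidal.slash (hF : IsCuspidal L k F) (γ : SL(2, ℤ)) : IsCuspidal L k (F ∣[k] γ) where
  continuous := continuous_slash k hF.continuous (mapGL ℝ γ)
  slash_eq g hg := by
    have h : γ * g = (γ * g * γ⁻¹) * γ := by group
    rw [← SlashAction.slash_mul, h, SlashAction.slash_mul,
      hF.slash_eq _ ((Gamma_normal L).conj_mem g hg γ)]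
  bounded := exists_petersson_slash_bound hF.bounded (mapGL ℝ γ)

theorem IsCuspidal.smul (hF : IsCuspidal L k F) (c : ℂ) : IsCuspidal L k (c • F) where
  continuous := hF.continuous.const_smul c
  slash_eq g hg := by rw [ModularForm.SL_smul_slash, hF.slash_eq g hg]
  bounded := by
    obtain ⟨C, hC⟩ := hF.bounded
    refine ⟨‖conj c * c‖ * C, fun z ↦ ?_⟩
    rw [petersson_smul_smul, norm_mul]
    gcongr
    exact hC z

theorem IsCuspidal.measurable_petersson (hF : IsCuspidal L k F) (hG : IsCuspidal L k G) :
    Measurable (UpperHalfPlane.petersson k G F) :=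
  (petersson_continuous k hG.continuous hF.continuous).measurable

theorem IsCuspidal.petersson_bounded (hF : IsCuspidal L k F) (hG : IsCuspidal L k G) :
    ∃ C, ∀ z, ‖UpperHalfPlane.petersson k G F z‖ ≤ C := by
  obtain ⟨C, hC⟩ := hF.bounded
  obtain ⟨D, hD⟩ := hG.bounded
  refine ⟨√(D * C), fun z ↦ Real.le_sqrt_of_sq_le ?_⟩
  rw [petersson_norm_sq]
  exact mul_le_mul (hD z) (hC z) (norm_nonneg _) ((norm_nonneg _).trans (hD z))

theorem IsCuspidal.petersson_smul (hF : IsCuspidal L k F) (hG : IsCuspidal L k G) :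
    ∀ γ ∈ Gamma L, ∀ z, UpperHalfPlane.petersson k G F (γ • z) =
      UpperHalfPlane.petersson k G F z := by
  intro γ hγ z
  rw [← petersson_slash_SL, hF.slash_eq γ hγ, hG.slash_eq γ hγ]

variable [NeZero L]

/-- The Petersson product of functions on `Γ(L)`, as a mean value. -/
noncomputable def pairing (L : ℕ) [NeZero L] (k : ℤ) (F G : ℍ → ℂ) : ℂ :=
  mean (Gamma L) (UpperHalfPlane.petersson k G F)

theorem pairing_smul_smul (a b : ℂ) (F G : ℍ → ℂ) :
    pairing L k (a • F) (b • G) = conj b * a * pairing L k F G := by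
  rw [pairing, pairing, ← mean_const_mul]
  congr 1
  ext z
  exact petersson_smul_smul k F G a b z

theorem pairing_smul_left (a : ℂ) (F G : ℍ → ℂ) :
    pairing L k (a • F) G = a * pairing L k F G := by
  simpa using pairing_smul_smul (L := L) (k := k) a 1 F G

theorem pairing_conj (F G : ℍ → ℂ) : conj (pairing L k F G) = pairing L k G F := by
  rw [pairing, pairing, ← mean_conj]
  congr 1
  ext z
  exact (petersson_symm k G F z).symm

theorem pairing_sum_left {ι : Type*} (s : Finset ι) {F : ι → ℍ → ℂ}
    (hF : ∀ i ∈ s, IsCuspidal L k (F i)) (hG : IsCuspidal L k G) :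
    pairing L k (∑ i ∈ s, F i) G = ∑ i ∈ s, pairing L k (F i) G := by
  rw [pairing, petersson_sum_right, mean_sum s (fun i hi ↦ (hF i hi).measurable_petersson hG)
    fun i hi ↦ (hF i hi).petersson_bounded hG]
  rfl

theorem pairing_slash (hF : IsCuspidal L k F) (hG : IsCuspidal L k G) (γ : SL(2, ℤ)) :
    pairing L k (F ∣[k] γ) (G ∣[k] γ) = pairing L k F G := by
  rw [pairing, pairing,
    ← mean_comp_smul γ (hF.measurable_petersson hG) (hF.petersson_smul hG)]
  congr 1
  ext z
  exact petersson_slash_SL k G F γ z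

end Pairing

/-! ### T(1, n) against the Petersson pairing -/

section HeckePairing

open UpperHalfPlane CongruenceSubgroup Matrix.SpecialLinearGroup

variable {N : ℕ} {k : ℤ} {χ : DirichletCharacter ℂ N} {f : ℍ → ℂ}

/-- Moving γ past diag(1, m) replaces it by an element of Γ₀(Nm) with the same lower right entry. -/
theorem slash_diagGL_slash (hf : HasCharacter N k χ f) (m : ℕ) [NeZero m] {γ : SL(2, ℤ)}
    (hγ : γ ∈ Gamma00 N m) :
    (f ∣[k] diagGL 1 m) ∣[k] γ = χ ((γ 1 1 : ℤ) : ZMod N) • (f ∣[k] diagGL 1 m) := by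
  have h : f ∣[k] (mapGL ℝ (conjDiag m γ hγ.2)) = χ ((γ 1 1 : ℤ) : ZMod N) • f :=
    hf _ (Gamma0_le_of_dvd (Dvd.intro m rfl) (conjDiag_mem_Gamma0 hγ))
  rw [ModularForm.SL_slash]
  change (f ∣[k] diagGL 1 m) ∣[k] (mapGL ℝ γ) = _
  rw [← SlashAction.slash_mul, diagGL_mul_mapGL m γ hγ.2, SlashAction.slash_mul, h,
    slash_const_smul k (det_diagGL_pos 1 m)]

theorem isCuspidal_slash_diagGL (hf : HasCharacter N k χ f) (hc : Continuous f)
    (hb : ∃ C, ∀ z, ‖UpperHalfPlane.petersson k f f z‖ ≤ C) {L m : ℕ} [NeZero m]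
    (hN : N ∣ L) (hm : m ∣ L) : IsCuspidal L k (f ∣[k] diagGL 1 m) where
  continuous := continuous_slash k hc _
  slash_eq γ hγ := by
    rw [slash_diagGL_slash hf m (Gamma_le_Gamma00 hN hm hγ)]
    have h : ((γ 1 1 : ℤ) : ZMod N) = 1 := by
      have h₁ := congrArg (ZMod.castHom hN (ZMod N)) (Gamma_mem.mp hγ).2.2.2
      rwa [map_intCast, map_one] at h₁
    rw [h, map_one, one_smul]
  bounded := exists_petersson_slash_bound hb _

theorem heckeTerm_diagGL_mul (f : ℍ → ℂ) (n : ℕ) [NeZero n] (γ : SL(2, ℤ)) :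
    heckeTerm N k χ f (diagGL 1 n * mapGL ℝ γ) =
      χ ((γ 0 0 : ℤ) : ZMod N) • ((f ∣[k] diagGL 1 n) ∣[k] γ) := by
  have h : (diagGL 1 n * mapGL ℝ γ) 0 0 = ((γ 0 0 : ℤ) : ℝ) := by
    rw [Units.val_mul, coe_diagGL, Matrix.mul_apply, Fin.sum_univ_two]
    simp only [mapGL_apply]
    simp
  rw [heckeTerm, h, Int.floor_intCast, SlashAction.slash_mul]
  rfl

/-- The Hecke operator `T(1, n)` and the Petersson product: for coprime `n` and `m`, all cosets
of the double coset of `diag(1, n)` contribute equally. -/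
theorem pairing_heckeT (hf : HasCharacter N k χ f) (hc : Continuous f)
    (hb : ∃ C, ∀ z, ‖UpperHalfPlane.petersson k f f z‖ ≤ C) {L n m : ℕ} [NeZero N] [NeZero L]
    [NeZero n] [NeZero m] (hN : N ∣ L) (hn : n ∣ L) (hm : m ∣ L) (h : n.Coprime m) :
    pairing L k (heckeT N k χ 1 n f) (f ∣[k] diagGL 1 m) =
      (Gamma00 N n).relIndex (Gamma0 N) *
        pairing L k (f ∣[k] diagGL 1 n) (f ∣[k] diagGL 1 m) := by
  have hfin := finite_rightCoset_image_doubleCoset N n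
  have hFn := isCuspidal_slash_diagGL hf hc hb hN hn
  have hFm := isCuspidal_slash_diagGL hf hc hb hN hm
  have hterm : ∀ q ∈ rightCoset N '' doubleCoset N 1 n, ∃ γ ∈ Gamma00 N m,
      heckeTerm N k χ f q.out = χ ((γ 0 0 : ℤ) : ZMod N) • ((f ∣[k] diagGL 1 n) ∣[k] γ) := by
    intro q hq
    rw [rightCoset_image_doubleCoset_of_coprime N h] at hq
    obtain ⟨γ, hγ, rfl⟩ := hq
    refine ⟨γ, hγ, ?_⟩
    have hβ := (isHeckeMatrix_diagGL N 1 n).mul (isHeckeMatrix_mapGL (Gamma00_le_Gamma0 N m hγ))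
    rw [← heckeTerm_diagGL_mul]
    exact heckeTerm_out hf hβ
  rw [heckeT_eq, finsum_mem_eq_finite_toFinset_sum _ hfin, pairing_sum_left _ _ hFm,
    Finset.sum_eq_card_nsmul (b := pairing L k (f ∣[k] diagGL 1 n) (f ∣[k] diagGL 1 m)),
    ← Set.ncard_eq_toFinset_card _ hfin, ncard_rightCoset_image_doubleCoset, nsmul_eq_mul]
  · intro q hq
    obtain ⟨γ, hγ, hq'⟩ := hterm q (hfin.mem_toFinset.mp hq)
    have hχ := char_mul_eq_one χ (Gamma00_le_Gamma0 N m hγ)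
    have hunit : IsUnit ((γ 0 0 : ℤ) : ZMod N) := by
      by_contra hu
      rw [χ.map_nonunit hu, zero_mul] at hχ
      exact zero_ne_one hχ
    have hnorm : conj (χ ((γ 0 0 : ℤ) : ZMod N)) * χ ((γ 0 0 : ℤ) : ZMod N) = 1 := by
      rw [RCLike.conj_mul, ← hunit.unit_spec, χ.unit_norm_eq_one]
      simp
    -- Since χ(a)χ(d) = 1, the second argument can be given the same scalar χ(a) and the same slash
    -- by γ as the first; the scalar has modulus 1 and the pairing is invariant under γ.
    have hG : f ∣[k] diagGL 1 m =
        χ ((γ 0 0 : ℤ) : ZMod N) • ((f ∣[k] diagGL 1 m) ∣[k] γ) := by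
      rw [slash_diagGL_slash hf m hγ, smul_smul, hχ, one_smul]
    rw [hq']
    conv_lhs => rw [hG]
    rw [pairing_smul_smul, hnorm, one_mul, pairing_slash hFn hFm]
  · intro q hq
    obtain ⟨γ, hγ, hq'⟩ := hterm q (hfin.mem_toFinset.mp hq)
    rw [hq']
    exact (hFn.slash γ).smul _

/-- `pairing_heckeT` is used for (n, m) and for (m, 1); conjugating the latter brings in the
conjugate of λ(1, m). -/
theorem pairing_diagGL (hf : HasCharacter N k χ f) (hc : Continuous f)
    (hb : ∃ C, ∀ z, ‖UpperHalfPlane.petersson k f f z‖ ≤ C) {lam : ℕ → ℂ}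
    (hlam : ∀ r : ℕ, 0 < r → heckeT N k χ 1 r f = lam r • f) {L n m : ℕ} [NeZero N] [NeZero L]
    [NeZero n] [NeZero m] (hN : N ∣ L) (hn : n ∣ L) (hm : m ∣ L) (h : n.Coprime m) :
    pairing L k (f ∣[k] diagGL 1 n) (f ∣[k] diagGL 1 m) =
      lam n * conj (lam m) / ((Gamma00 N (n * m)).relIndex (Gamma0 N) : ℂ) * pairing L k f f := by
  have hn0 : ((Gamma00 N n).relIndex (Gamma0 N) : ℂ) ≠ 0 := mod_cast relIndex_Gamma00_ne_zero N n
  have hm0 : ((Gamma00 N m).relIndex (Gamma0 N) : ℂ) ≠ 0 := mod_cast relIndex_Gamma00_ne_zero N m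
  have h₁ := pairing_heckeT hf hc hb hN hn hm h
  have h₂ := pairing_heckeT hf hc hb hN hm (one_dvd L) (Nat.coprime_one_right m)
  rw [hlam n (NeZero.pos n), pairing_smul_left] at h₁
  rw [hlam m (NeZero.pos m), diagGL_one_one, SlashAction.slash_one, pairing_smul_left] at h₂
  have h₃ := congrArg conj h₂
  rw [map_mul, map_mul, pairing_conj, pairing_conj, Complex.conj_natCast] at h₃
  rw [relIndex_Gamma00_mul N (NeZero.ne n) (NeZero.ne m) h, Nat.cast_mul]
  field_simp
  linear_combination -(((Gamma00 N m).relIndex (Gamma0 N) : ℂ)) * h₁ - lam n * h₃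

end HeckePairing

/-! ### From V_m to diag(1, n) by the substitution z ↦ Dz -/

section Transport

open UpperHalfPlane CongruenceSubgroup Matrix.SpecialLinearGroup

variable {N : ℕ} {k : ℤ} {χ : DirichletCharacter ℂ N} {f : ℍ → ℂ}

theorem coe_diagGL_inv_smul (D : ℕ) [NeZero D] (z : ℍ) :
    (((diagGL 1 D)⁻¹ • z : ℍ) : ℂ) = D * z := by
  have hD : (D : ℂ) ≠ 0 := mod_cast NeZero.ne D
  have h : diagGL 1 D • ((diagGL 1 D)⁻¹ • z) = z := smul_inv_smul _ _
  have h' := congrArg UpperHalfPlane.coe h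
  rw [coe_smul_of_det_pos (det_diagGL_pos 1 D)] at h'
  simp only [num, denom, coe_diagGL] at h'
  simp at h'
  rw [← h']
  field_simp

/-- Conjugation by `diag(1, D)` identifies `Γ₀(N) ∩ Γ⁰(D)` with `Γ₀(ND)`. -/
noncomputable def conjDiagEquiv (N D : ℕ) [NeZero D] : Gamma00 N D ≃ Gamma0 (N * D) :=
  Equiv.ofBijective (fun γ ↦ ⟨conjDiag D γ γ.2.2, conjDiag_mem_Gamma0 γ.2⟩) <| by
    have hD : (D : ℤ) ≠ 0 := mod_cast NeZero.ne D
    constructor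
    · rintro ⟨x, hx⟩ ⟨y, hy⟩ h
      have h₁ : mapGL ℝ (conjDiag D x hx.2) = mapGL ℝ (conjDiag D y hy.2) :=
        congrArg (fun g : Gamma0 (N * D) ↦ mapGL ℝ (g : SL(2, ℤ))) h
      have h₂ : diagGL 1 D * mapGL ℝ x = diagGL 1 D * mapGL ℝ y := by
        rw [diagGL_mul_mapGL D x hx.2, diagGL_mul_mapGL D y hy.2, h₁]
      exact Subtype.ext (mapGL_injective (mul_left_cancel h₂))
    · rintro ⟨y, hy⟩
      obtain ⟨c, hc⟩ := dvd_of_mem_Gamma0 hy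
      refine ⟨⟨⟨!![y 0 0, D * y 0 1; N * c, y 1 1], ?_⟩, mem_Gamma00.mpr (by simp)⟩, ?_⟩
      · have hdet := det_eq y
        rw [hc] at hdet
        push_cast at hdet
        rw [Matrix.det_fin_two_of]
        linear_combination hdet
      · refine Subtype.ext (Subtype.ext ?_)
        ext i j
        fin_cases i <;> fin_cases j <;> simp [conjDiag, Int.mul_ediv_cancel_left _ hD, hc]
        ring

theorem diagGL_inv_smul_smul {D : ℕ} [NeZero D] (g : Gamma0 (N * D)) (z : ℍ) :
    (diagGL 1 D)⁻¹ • (g : SL(2, ℤ)) • z =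
      ((conjDiagEquiv N D).symm g : SL(2, ℤ)) • (diagGL 1 D)⁻¹ • z := by
  obtain ⟨γ, rfl⟩ := (conjDiagEquiv N D).surjective g
  rw [Equiv.symm_apply_apply]
  change (diagGL 1 D)⁻¹ • mapGL ℝ (conjDiag D γ γ.2.2) • z = mapGL ℝ (γ : SL(2, ℤ)) • _
  rw [smul_smul, smul_smul]
  congr 1
  rw [inv_mul_eq_iff_eq_mul, ← mul_assoc, diagGL_mul_mapGL D γ γ.2.2, mul_inv_cancel_right]

/-- mz = (Dz)/n, and the factor n undoes the n^(k-1) n^(-k) of the slash operator. -/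
theorem V_eq_slash_diagGL (k : ℤ) (f : ℍ → ℂ) {m n D : ℕ} [NeZero n] [NeZero D]
    (h : D = m * n) (z : ℍ) :
    V m f z = n * (f ∣[k] diagGL 1 n) ((diagGL 1 D)⁻¹ • z) := by
  have hn : (n : ℂ) ≠ 0 := mod_cast NeZero.ne n
  have harg : ofComplex ((m : ℂ) * z) = diagGL 1 n • (diagGL 1 D)⁻¹ • z := by
    have hcoe : (m : ℂ) * z = ((diagGL 1 n • (diagGL 1 D)⁻¹ • z : ℍ) : ℂ) := by
      rw [coe_smul_of_det_pos (det_diagGL_pos 1 n)]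
      simp only [num, denom, coe_diagGL, coe_diagGL_inv_smul, h]
      simp
      field_simp
    rw [hcoe, ofComplex_apply]
  rw [V, harg, slash_diagGL_apply, Nat.cast_one, one_mul, mul_assoc, ← zpow_add₀ hn,
    show k - 1 + -k = -1 by ring, zpow_neg_one]
  field_simp

theorem petersson_V_V (k : ℤ) (f : ℍ → ℂ) {m n m' n' D : ℕ} [NeZero m'] [NeZero n'] [NeZero D]
    (hm : D = m * n') (hn : D = n * m') :
    UpperHalfPlane.petersson k (V n f) (V m f) = fun z ↦ ((n' * m' : ℕ) / (D : ℂ) ^ k) *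
      UpperHalfPlane.petersson k (f ∣[k] diagGL 1 m') (f ∣[k] diagGL 1 n')
        ((diagGL 1 D)⁻¹ • z) := by
  ext z
  have hD : (D : ℂ) ≠ 0 := mod_cast NeZero.ne D
  have him : ((((diagGL 1 D)⁻¹ • z : ℍ).im : ℝ) : ℂ) = D * z.im := by
    rw [← coe_im, coe_diagGL_inv_smul]
    simp
  rw [UpperHalfPlane.petersson, UpperHalfPlane.petersson, V_eq_slash_diagGL k f hm,
    V_eq_slash_diagGL k f hn, him, mul_zpow, map_mul, Complex.conj_natCast]
  have := zpow_ne_zero k hD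
  push_cast
  field_simp

theorem petersson_slash_diagGL_smul (hf : HasCharacter N k χ f) {m n : ℕ} [NeZero m] [NeZero n]
    {γ : SL(2, ℤ)} (hm : γ ∈ Gamma00 N m) (hn : γ ∈ Gamma00 N n) (z : ℍ) :
    UpperHalfPlane.petersson k (f ∣[k] diagGL 1 m) (f ∣[k] diagGL 1 n) (γ • z) =
      UpperHalfPlane.petersson k (f ∣[k] diagGL 1 m) (f ∣[k] diagGL 1 n) z := by
  have hχ := char_mul_eq_one χ hm.1
  have hunit : IsUnit ((γ 1 1 : ℤ) : ZMod N) := by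
    by_contra hu
    rw [χ.map_nonunit hu, mul_zero] at hχ
    exact zero_ne_one hχ
  have hnorm : conj (χ ((γ 1 1 : ℤ) : ZMod N)) * χ ((γ 1 1 : ℤ) : ZMod N) = 1 := by
    rw [RCLike.conj_mul, ← hunit.unit_spec, χ.unit_norm_eq_one]
    simp
  rw [← petersson_slash_SL, slash_diagGL_slash hf m hm, slash_diagGL_slash hf n hn,
    petersson_smul_smul, hnorm, one_mul]

/-- The Petersson product of `f | V_m` and `f | V_n` in terms of `f | diag(1, n')` and
`f | diag(1, m')`, where `m n' = n m'`. -/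
theorem petersson_V_eq_pairing (hf : HasCharacter N k χ f) (hc : Continuous f)
    {m n m' n' D M : ℕ} [NeZero N] [NeZero m'] [NeZero n'] [NeZero D] [NeZero M]
    (hm : D = m * n') (hn : D = n * m') (hM : N * D ∣ M) :
    petersson M k (V m f) (V n f) = (volume ModularGroup.fd).toReal *
      (((n' * m' : ℕ) / (D : ℂ) ^ k) *
        pairing (N * D) k (f ∣[k] diagGL 1 n') (f ∣[k] diagGL 1 m')) := by
  set φ := UpperHalfPlane.petersson k (f ∣[k] diagGL 1 m') (f ∣[k] diagGL 1 n') with hφ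
  have hφm : Measurable φ :=
    (petersson_continuous k (continuous_slash k hc _) (continuous_slash k hc _)).measurable
  have hφi : ∀ γ ∈ Gamma00 N D, ∀ z, φ (γ • z) = φ z := fun γ hγ z ↦
    petersson_slash_diagGL_smul hf (Gamma00_le_of_dvd N (hn ▸ Dvd.intro_left n rfl) hγ)
      (Gamma00_le_of_dvd N (hm ▸ Dvd.intro_left m rfl) hγ) z
  have hψm : Measurable fun z ↦ φ ((diagGL 1 D)⁻¹ • z) :=
    hφm.comp (measurable_const_smul _)
  have hψi : ∀ γ ∈ Gamma0 (N * D), ∀ z : ℍ,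
      φ ((diagGL 1 D)⁻¹ • γ • z) = φ ((diagGL 1 D)⁻¹ • z) := by
    intro γ hγ z
    rw [diagGL_inv_smul_smul ⟨γ, hγ⟩, hφi _ ((conjDiagEquiv N D).symm ⟨γ, hγ⟩).2]
  -- The group passes from Γ₀(M) to Γ₀(ND), by conjugation to Γ₀(N) ∩ Γ⁰(D), and finally down to
  -- Γ(ND).
  rw [petersson_eq_mean, petersson_V_V k f hm hn, mean_const_mul, pairing, ← hφ,
    mean_eq_of_le (Gamma0_le_of_dvd hM) hψm hψi,
    mean_comp (diagGL 1 D)⁻¹ (conjDiagEquiv N D).symm diagGL_inv_smul_smul hφm hφi,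
    mean_eq_of_le (Gamma_le_Gamma00 (Dvd.intro D rfl) (Dvd.intro_left N rfl)) hφm hφi]

theorem petersson_self_eq_pairing (hf : HasCharacter N k χ f) (hc : Continuous f) {L : ℕ}
    [NeZero N] [NeZero L] (hL : N ∣ L) :
    petersson N k f f = (volume ModularGroup.fd).toReal * pairing L k f f := by
  have hinv : ∀ γ ∈ Gamma0 N, ∀ z : ℍ,
      UpperHalfPlane.petersson k f f (γ • z) = UpperHalfPlane.petersson k f f z := by
    intro γ hγ z
    have h := petersson_slash_diagGL_smul (m := 1) (n := 1) hf (γ := γ) (by rwa [Gamma00_one])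
      (by rwa [Gamma00_one]) z
    simpa only [diagGL_one_one, SlashAction.slash_one] using h
  rw [petersson_eq_mean, pairing, mean_eq_of_le
    ((Gamma_le_Gamma00 hL (one_dvd L)).trans (Gamma00_le_Gamma0 N 1))
    (petersson_continuous k hc hc).measurable hinv]

end Transport

end GramMatrix

/-! ### The Gram matrix formula -/

theorem mainTheorem1 (N : ℕ) (hN : 0 < N) (k : ℤ) (χ : DirichletCharacter ℂ N)
    (f : CuspForm ((CongruenceSubgroup.Gamma1 N : Subgroup SL(2, ℤ)) : Subgroup (GL (Fin 2) ℝ)) k)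
    (hf : GramMatrix.IsPrimitiveForm N k χ f) :
    ∃ lam : ℕ → ℂ,
      (∀ r : ℕ, 0 < r → GramMatrix.heckeT N k χ 1 r f = lam r • (f : UpperHalfPlane → ℂ)) ∧
      ∀ m n : ℕ, 0 < m → 0 < n → ∀ M : ℕ, 0 < M → N * m ∣ M → N * n ∣ M →
        GramMatrix.petersson M k (GramMatrix.V m f) (GramMatrix.V n f) =
          lam (n / m.gcd n) * conj (lam (m / m.gcd n)) /
            ((((m * n / m.gcd n : ℕ) : ℂ)) ^ k *
              ∏ p ∈ (m * n / m.gcd n ^ 2).primeFactors with ¬ p ∣ N, (1 + 1 / (p : ℂ))) *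
            GramMatrix.petersson N k f f := by
  have : NeZero N := ⟨hN.ne'⟩
  have hchar : GramMatrix.HasCharacter N k χ f := hf.mem
  have hcont : Continuous (f : UpperHalfPlane → ℂ) := by fun_prop
  have hbdd := CuspFormClass.petersson_bounded_left k _ f f
  choose! lam hlam using GramMatrix.exists_heckeT_one_eq_smul hchar hf.eigen
  refine ⟨lam, hlam, fun m n hm hn M hM hmM hnM ↦ ?_⟩
  obtain ⟨m', n', hcop, hm', hn'⟩ := Nat.exists_coprime m n
  set d := m.gcd n with hd
  have hd0 : 0 < d := Nat.gcd_pos_of_pos_left n hm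
  have hm'0 : m' ≠ 0 := by rintro rfl; omega
  have hn'0 : n' ≠ 0 := by rintro rfl; omega
  have : NeZero m' := ⟨hm'0⟩
  have : NeZero n' := ⟨hn'0⟩
  have : NeZero M := ⟨hM.ne'⟩
  have : NeZero (m * n') := ⟨mul_ne_zero hm.ne' hn'0⟩
  have hD : m * n' = n * m' := by rw [hm', hn']; ring
  have h₁ : m / d = m' := by rw [hm', Nat.mul_div_cancel _ hd0]
  have h₂ : n / d = n' := by rw [hn', Nat.mul_div_cancel _ hd0]
  have h₃ : m * n / d = m * n' := by
    conv_lhs => rw [hn', ← mul_assoc, Nat.mul_div_cancel _ hd0]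
  have h₄ : m * n / d ^ 2 = n' * m' := by
    rw [pow_two, ← Nat.div_div_eq_div_mul, h₃]
    conv_lhs => rw [hm', mul_right_comm, Nat.mul_div_cancel _ hd0]
    exact mul_comm _ _
  -- Here m n' = lcm(m, n) plays the role of D, so ND is the smallest common level allowed by the
  -- two divisibilities.
  have hlcm : N * (m * n') ∣ M := by
    have h := Nat.lcm_dvd hmM hnM
    rwa [Nat.lcm_mul_left, Nat.lcm, ← hd, h₃] at h
  have hlam' := GramMatrix.pairing_diagGL hchar hcont hbdd hlam (L := N * (m * n'))
    (Dvd.intro _ rfl) ((Dvd.intro_left m rfl).mul_left N)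
    ((hD ▸ Dvd.intro_left n rfl : m' ∣ m * n').mul_left N) hcop.symm
  rw [GramMatrix.petersson_V_eq_pairing hchar hcont rfl hD hlcm, hlam',
    GramMatrix.petersson_self_eq_pairing hchar hcont (Dvd.intro _ rfl : N ∣ N * (m * n')),
    GramMatrix.relIndex_Gamma00 N (mul_ne_zero hn'0 hm'0), h₁, h₂, h₃, h₄]
  -- The n'm' from the two V operators cancels the n'm' in the index, leaving only the Euler
  -- product.
  have hnm : ((n' * m' : ℕ) : ℂ) ≠ 0 := mod_cast mul_ne_zero hn'0 hm'0
  field_simp
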